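/- Let $A\in\mathbb{R}^{n\times n}$ be invertible, $B\in\mathbb{R}^{n\times m}$, let $Q\in\mathbb{R}^{n\times n}$ and $R\in\mathbb{R}^{m\times m}$ be symmetric positive definite, and let $\gamma>0$. Write $|x|_M^2=x^\top Mx$, $|x|^2=x^\top x$, $\|C\|_M^2=\operatorname{tr}(C^\top MC)$, $\langle C,D\rangle=\operatorname{tr}(C^\top D)$, and $\mathrm{sat}(y)=\max\{-1,\min\{1,y\}\}$. Game. For an initial state $x_0\in\mathbb{R}^n$ consider the value $$\inf_\mu\ \sup_{w,i,N}\ \sum_{t=0}^N\left(|x_t|_Q^2+|u_t|_R^2-\gamma^2|w_t|^2\right)\in[-\infty,\infty],\qquad(1)$$ where $i\in\{-1,1\}$, $w_t\in\mathbb{R}^n$, $N\ge0$, and $x_{t+1}=iAx_t+Bu_t+w_t$, $u_t=\mu_t(x_0,\dots,x_t,u_0,\dots,u_{t-1})$, the $\mu_t$ being arbitrary functions. Bellman iterations. For $V:\mathbb{R}^n\times\mathbb{R}^{2n\times2n}\to[-\infty,\infty]$ let $$\mathcal{F}V(x,Z)=\inf_{u\in\mathbb{R}^m}\sup_{v\in\mathbb{R}^n}\left\{|x|_Q^2+|u|_R^2+V\left(v,\,Z+\begin{bmatrix}Bu-v\\x\end{bmatrix}\begin{bmatrix}Bu-v\\x\end{bmatrix}^\top\right)\right\}.$$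 Put $V_0(x,Z)=-\gamma^2\min_{i=\pm1}\|[I\ \ iA]^\top\|_Z^2$ and $V_{k+1}=\mathcal{F}V_k$. For a symmetric matrix $P$ put $\bar V_0(x,Z)=|x|_P^2-\gamma^2\min_{i=\pm1}\|[I\ \ iA]^\top\|_Z^2$ and $\bar V_{k+1}=\mathcal{F}\bar V_k$. Riccati equation. Let $P$ with $0\prec P\prec\gamma^2I$ satisfy $$|x|_P^2=\min_u\max_v\left\{|x|_Q^2+|u|_R^2-\gamma^2|Ax+Bu-v|^2+|v|_P^2\right\}\quad\text{for all }x\in\mathbb{R}^n,\qquad(2)$$ with minimizing argument $u=-Kx$, $K\in\mathbb{R}^{m\times n}$. Let $T:=Q+A^\top(P^{-1}-\gamma^{-2}I)^{-1}A$ and assume that $T-P$ is invertible. Then the following two conditions are equivalent: (i) the value (1) is finite for every $x_0$, and $\bar V_k(x,Z)=\bar V_1(x,Z)$ for all $k\ge1$, all $x\in\mathbb{R}^n$ and all positive semi-definite $Z\in\mathbb{R}^{2n\times2n}$; (ii) $(\gamma^2I-P)(T-P)^{-1}(\gamma^2I-P)\succeq(I\pm BKA^{-1})(\gamma^2I-P)(I\pm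 BKA^{-1})^\top$ for both the "$+$" and the "$-$" sign. Moreover, suppose that (i) and (ii) hold and that $P$ is the least solution of (2), that is, $P\preceq P'$ for every solution $P'$ of (2) with $0\prec P'\prec\gamma^2I$. Then the control law $$u_t=\mathrm{sat}\left(\frac{\gamma^2\sum_{\tau=0}^{t-1}(Bu_\tau-x_{\tau+1})^\top Ax_\tau}{|x_t|^2_{T-P}}\right)Kx_t$$ (read as $u_t=0$ if $x_t=0$) attains the infimum in (1) for every $x_0$, and, for all $x\in\mathbb{R}^n$ and all positive semi-definite $Z\in\mathbb{R}^{2n\times2n}$, with $Y:=\gamma^2[I\ \ 0]\,Z\,[0\ \ I]^\top$, the limit $V_*(x,Z)=\lim_{k\to\infty}V_k(x,Z)$ exists and equals $$V_*(x,Z)=\begin{cases}|x|_P^2-\gamma^2\min_{i=\pm1}\|[I\ \ iA]^\top\|_Z^2&\text{if }|\langle A,Y\rangle|\ge|x|_{T-P}^2,\\[1mm]|x|_T^2-\gamma^2\|\mathrm{diag}\{I,A\}^\top\|_Z^2+\dfrac{\langle A,Y\rangle^2}{|x|_{T-P}^2}&\text{otherwise.}\end{cases}$$ -/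

import Mathlib

open Matrix

noncomputable section

namespace SignGame

variable {n m : ℕ}

/-- `|x|²_M = xᵀ M x`. -/
def qf {k : ℕ} (M : Matrix (Fin k) (Fin k) ℝ) (x : Fin k → ℝ) : ℝ := x ⬝ᵥ (M *ᵥ x)

/-- `‖C‖²_M = tr (Cᵀ M C)`. -/
def matSq {ι κ : Type} [Fintype ι] [Fintype κ] (C : Matrix ι κ ℝ) (M : Matrix ι ι ℝ) : ℝ :=
  (Cᵀ * M * C).trace

/-- The saturation function. -/
def sat (y : ℝ) : ℝ := if 1 < y then 1 else if y < -1 then -1 else y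

/-! ### The game -/

/-- A control law: `u_t = μ_t (x_0, …, x_t, u_0, …, u_{t-1})`. -/
abbrev ControlLaw (n m : ℕ) : Type :=
  (t : ℕ) → (Fin (t + 1) → Fin n → ℝ) → (Fin t → Fin m → ℝ) → Fin m → ℝ

/-- `x, u` are generated from `x₀`, the sign `i` and the disturbance `w` by the plant
`x_{t+1} = i A x_t + B u_t + w_t` and the control law `μ`. -/
def IsTrajectory (A : Matrix (Fin n) (Fin n) ℝ) (B : Matrix (Fin n) (Fin m) ℝ)
    (μ : ControlLaw n m) (x₀ : Fin n → ℝ) (i : ℝ) (w : ℕ → Fin n → ℝ)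
    (x : ℕ → Fin n → ℝ) (u : ℕ → Fin m → ℝ) : Prop :=
  x 0 = x₀ ∧
  (∀ t, x (t + 1) = i • (A *ᵥ x t) + B *ᵥ u t + w t) ∧
  (∀ t, u t = μ t (fun τ => x τ) (fun τ => u τ))

/-- The cost `∑_{t=0}^N (|x_t|²_Q + |u_t|²_R - γ² |w_t|²)`. -/
def cost (Q : Matrix (Fin n) (Fin n) ℝ) (R : Matrix (Fin m) (Fin m) ℝ) (γ : ℝ)
    (w x : ℕ → Fin n → ℝ) (u : ℕ → Fin m → ℝ) (N : ℕ) : ℝ :=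
  ∑ t ∈ Finset.range (N + 1), (qf Q (x t) + qf R (u t) - γ ^ 2 * (w t ⬝ᵥ w t))

/-- The supremum of the cost over `w`, `i ∈ {-1, 1}` and `N ≥ 0` under the control law `μ`. -/
def worstCost (A : Matrix (Fin n) (Fin n) ℝ) (B : Matrix (Fin n) (Fin m) ℝ)
    (Q : Matrix (Fin n) (Fin n) ℝ) (R : Matrix (Fin m) (Fin m) ℝ) (γ : ℝ)
    (μ : ControlLaw n m) (x₀ : Fin n → ℝ) : EReal :=
  sSup {c : EReal | ∃ (i : ℝ) (w x : ℕ → Fin n → ℝ) (u : ℕ → Fin m → ℝ) (N : ℕ),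
    (i = 1 ∨ i = -1) ∧ IsTrajectory A B μ x₀ i w x u ∧ c = (cost Q R γ w x u N : EReal)}

/-- The value of the game with initial state `x₀`. -/
def gameValue (A : Matrix (Fin n) (Fin n) ℝ) (B : Matrix (Fin n) (Fin m) ℝ)
    (Q : Matrix (Fin n) (Fin n) ℝ) (R : Matrix (Fin m) (Fin m) ℝ) (γ : ℝ)
    (x₀ : Fin n → ℝ) : EReal :=
  ⨅ μ : ControlLaw n m, worstCost A B Q R γ μ x₀

/-- `μ` attains the infimum for every initial state. -/
def IsOptimal (A : Matrix (Fin n) (Fin n) ℝ) (B : Matrix (Fin n) (Fin m) ℝ)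
    (Q : Matrix (Fin n) (Fin n) ℝ) (R : Matrix (Fin m) (Fin m) ℝ) (γ : ℝ)
    (μ : ControlLaw n m) : Prop :=
  ∀ x₀, worstCost A B Q R γ μ x₀ = gameValue A B Q R γ x₀

/-! ### The Bellman operator -/

/-- The matrices `Z` collecting the data, of size `2n × 2n` in `n × n` blocks. -/
abbrev ZMat (n : ℕ) : Type := Matrix (Fin n ⊕ Fin n) (Fin n ⊕ Fin n) ℝ

/-- `Z + [Bu - v; x] [Bu - v; x]ᵀ`. -/
def updateZ (B : Matrix (Fin n) (Fin m) ℝ) (x : Fin n → ℝ) (Z : ZMat n)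
    (u : Fin m → ℝ) (v : Fin n → ℝ) : ZMat n :=
  Z + vecMulVec (Sum.elim (B *ᵥ u - v) x) (Sum.elim (B *ᵥ u - v) x)

/-- The Bellman operator, on extended-real-valued functions. -/
def bellman (B : Matrix (Fin n) (Fin m) ℝ)
    (Q : Matrix (Fin n) (Fin n) ℝ) (R : Matrix (Fin m) (Fin m) ℝ)
    (V : (Fin n → ℝ) → ZMat n → EReal) (x : Fin n → ℝ) (Z : ZMat n) : EReal :=
  ⨅ u : Fin m → ℝ, ⨆ v : Fin n → ℝ,
    ((qf Q x + qf R u : ℝ) : EReal) + V v (updateZ B x Z u v)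

/-- `min_{i = ±1} ‖[I  iA]ᵀ‖²_Z`. -/
def minSign (A : Matrix (Fin n) (Fin n) ℝ) (Z : ZMat n) : ℝ :=
  min (matSq (fromCols (1 : Matrix (Fin n) (Fin n) ℝ) A)ᵀ Z)
    (matSq (fromCols (1 : Matrix (Fin n) (Fin n) ℝ) (-A))ᵀ Z)

/-- The iterates `V_k`, starting from `V_0(x,Z) = -γ² min_i ‖[I  iA]ᵀ‖²_Z`. -/
def V (A : Matrix (Fin n) (Fin n) ℝ) (B : Matrix (Fin n) (Fin m) ℝ)
    (Q : Matrix (Fin n) (Fin n) ℝ) (R : Matrix (Fin m) (Fin m) ℝ) (γ : ℝ) :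
    ℕ → (Fin n → ℝ) → ZMat n → EReal
  | 0 => fun _ Z => ((-(γ ^ 2 * minSign A Z) : ℝ) : EReal)
  | k + 1 => bellman B Q R (V A B Q R γ k)

/-- The iterates `V̄_k`, starting from `V̄_0(x,Z) = |x|²_P - γ² min_i ‖[I  iA]ᵀ‖²_Z`. -/
def Vbar (A : Matrix (Fin n) (Fin n) ℝ) (B : Matrix (Fin n) (Fin m) ℝ)
    (Q : Matrix (Fin n) (Fin n) ℝ) (R : Matrix (Fin m) (Fin m) ℝ) (γ : ℝ)
    (P : Matrix (Fin n) (Fin n) ℝ) : ℕ → (Fin n → ℝ) → ZMat n → EReal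
  | 0 => fun x Z => ((qf P x - γ ^ 2 * minSign A Z : ℝ) : EReal)
  | k + 1 => bellman B Q R (Vbar A B Q R γ P k)

/-! ### The Riccati equation -/

/-- `max_v {|x|²_Q + |u|²_R - γ² |Ax + Bu - v|² + |v|²_P}`. -/
def riccatiMax (A : Matrix (Fin n) (Fin n) ℝ) (B : Matrix (Fin n) (Fin m) ℝ)
    (Q : Matrix (Fin n) (Fin n) ℝ) (R : Matrix (Fin m) (Fin m) ℝ) (γ : ℝ)
    (P : Matrix (Fin n) (Fin n) ℝ) (x : Fin n → ℝ) (u : Fin m → ℝ) : EReal :=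
  ⨆ v : Fin n → ℝ, ((qf Q x + qf R u
    - γ ^ 2 * ((A *ᵥ x + B *ᵥ u - v) ⬝ᵥ (A *ᵥ x + B *ᵥ u - v)) + qf P v : ℝ) : EReal)

/-- `P` solves the Riccati equation and `0 ≺ P ≺ γ² I`. -/
def IsRiccatiSolution (A : Matrix (Fin n) (Fin n) ℝ) (B : Matrix (Fin n) (Fin m) ℝ)
    (Q : Matrix (Fin n) (Fin n) ℝ) (R : Matrix (Fin m) (Fin m) ℝ) (γ : ℝ)
    (P : Matrix (Fin n) (Fin n) ℝ) : Prop :=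
  P.PosDef ∧ (γ ^ 2 • (1 : Matrix (Fin n) (Fin n) ℝ) - P).PosDef ∧
  ∀ x, (qf P x : EReal) = ⨅ u : Fin m → ℝ, riccatiMax A B Q R γ P x u

/-- `u = -K x` is a minimizing argument in the Riccati equation, for every `x`. -/
def IsRiccatiGain (A : Matrix (Fin n) (Fin n) ℝ) (B : Matrix (Fin n) (Fin m) ℝ)
    (Q : Matrix (Fin n) (Fin n) ℝ) (R : Matrix (Fin m) (Fin m) ℝ) (γ : ℝ)
    (P : Matrix (Fin n) (Fin n) ℝ) (K : Matrix (Fin m) (Fin n) ℝ) : Prop :=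
  ∀ x u, riccatiMax A B Q R γ P x (-(K *ᵥ x)) ≤ riccatiMax A B Q R γ P x u

/-- `P` is the least solution of the Riccati equation between `0` and `γ² I`
(in the order of symmetric matrices). -/
def IsLeastRiccatiSolution (A : Matrix (Fin n) (Fin n) ℝ) (B : Matrix (Fin n) (Fin m) ℝ)
    (Q : Matrix (Fin n) (Fin n) ℝ) (R : Matrix (Fin m) (Fin m) ℝ) (γ : ℝ)
    (P : Matrix (Fin n) (Fin n) ℝ) : Prop :=
  IsRiccatiSolution A B Q R γ P ∧
  ∀ P', IsRiccatiSolution A B Q R γ P' → (P' - P).PosSemidef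

/-- `T = Q + Aᵀ (P⁻¹ - γ⁻² I)⁻¹ A`. -/
def Tmat (A Q : Matrix (Fin n) (Fin n) ℝ) (γ : ℝ) (P : Matrix (Fin n) (Fin n) ℝ) :
    Matrix (Fin n) (Fin n) ℝ :=
  Q + Aᵀ * (P⁻¹ - (γ ^ 2)⁻¹ • (1 : Matrix (Fin n) (Fin n) ℝ))⁻¹ * A

/-! ### The two conditions, the control law and the value function -/

/-- The value is finite for every initial state, and `V̄_k = V̄_1` for `k ≥ 1`. -/
def ConditionI (A : Matrix (Fin n) (Fin n) ℝ) (B : Matrix (Fin n) (Fin m) ℝ)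
    (Q : Matrix (Fin n) (Fin n) ℝ) (R : Matrix (Fin m) (Fin m) ℝ) (γ : ℝ)
    (P : Matrix (Fin n) (Fin n) ℝ) : Prop :=
  (∀ x₀, gameValue A B Q R γ x₀ ≠ ⊤ ∧ gameValue A B Q R γ x₀ ≠ ⊥) ∧
  ∀ k, 1 ≤ k → ∀ (x : Fin n → ℝ) (Z : ZMat n), Z.PosSemidef →
    Vbar A B Q R γ P k x Z = Vbar A B Q R γ P 1 x Z

/-- The matrix inequality, for both signs `ε = ±1`, with `G = γ² I - P`. -/
def ConditionII (A : Matrix (Fin n) (Fin n) ℝ) (B : Matrix (Fin n) (Fin m) ℝ)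
    (Q : Matrix (Fin n) (Fin n) ℝ) (γ : ℝ)
    (P : Matrix (Fin n) (Fin n) ℝ) (K : Matrix (Fin m) (Fin n) ℝ) : Prop :=
  let G : Matrix (Fin n) (Fin n) ℝ := γ ^ 2 • (1 : Matrix (Fin n) (Fin n) ℝ) - P
  ∀ ε : ℝ, ε = 1 ∨ ε = -1 →
    (G * (Tmat A Q γ P - P)⁻¹ * G
      - (1 + ε • (B * K * A⁻¹)) * G * (1 + ε • (B * K * A⁻¹))ᵀ).PosSemidef

/-- The control law
`u_t = sat (γ² ∑_{τ<t} (B u_τ - x_{τ+1})ᵀ A x_τ / |x_t|²_{T-P}) K x_t`. When `x_t = 0` the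
quotient is irrelevant, since then `K x_t = 0`. -/
def satLaw (A : Matrix (Fin n) (Fin n) ℝ) (B : Matrix (Fin n) (Fin m) ℝ)
    (Q : Matrix (Fin n) (Fin n) ℝ) (γ : ℝ)
    (P : Matrix (Fin n) (Fin n) ℝ) (K : Matrix (Fin m) (Fin n) ℝ) : ControlLaw n m :=
  fun t x u =>
    sat (γ ^ 2 * (∑ τ : Fin t, (B *ᵥ u τ - x τ.succ) ⬝ᵥ (A *ᵥ x τ.castSucc))
      / qf (Tmat A Q γ P - P) (x (Fin.last t))) • (K *ᵥ x (Fin.last t))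

/-- `⟨A, Y⟩ = tr (Aᵀ Y)`, where `Y = γ² [I 0] Z [0 I]ᵀ` is `γ²` times the upper right block
of `Z`. -/
def innerAY (A : Matrix (Fin n) (Fin n) ℝ) (γ : ℝ) (Z : ZMat n) : ℝ :=
  (Aᵀ * (γ ^ 2 • Z.toBlocks₁₂)).trace

open Classical in
/-- The piecewise formula for the value function. -/
def Vstar (A Q : Matrix (Fin n) (Fin n) ℝ) (γ : ℝ) (P : Matrix (Fin n) (Fin n) ℝ)
    (x : Fin n → ℝ) (Z : ZMat n) : ℝ :=
  if qf (Tmat A Q γ P - P) x ≤ |innerAY A γ Z| then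
    qf P x - γ ^ 2 * minSign A Z
  else
    qf (Tmat A Q γ P) x
      - γ ^ 2 * matSq (fromBlocks (1 : Matrix (Fin n) (Fin n) ℝ) 0 0 A)ᵀ Z
      + innerAY A γ Z ^ 2 / qf (Tmat A Q γ P - P) x

end SignGame

end

/-! Write `G = γ² I - P`, `M = γ⁴ G⁻¹ - γ² I`, `S = R + Bᵀ M B`. Completing squares in disturbance
and input gives `K = S⁻¹ Bᵀ M A`, `T = Q + Aᵀ M A` and `D := T - P = Kᵀ S K`, positive definite once
it is invertible.

For positive semidefinite `Z`, the data enter the iterates only through the scalar `y = ⟨A, Y⟩` and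
an additive term: `γ² ‖[I iA]ᵀ‖²_Z = diagCost + 2 i y`. A real `σ ∈ [-1, 1]` acts as the mean of a
randomized sign. Against any input, mixing the worst disturbances of both signs secures `|x|²_P + (1
- σ²) |x|²_D + 2 σ y`; its maximum over `σ` is `valueFn`. The input `θ K x` with `θ = sat (y /
|x|²_D)` meets this bound, so `V̄_1` is always `valueFn` (`Vbar_one_eq`).

Everything then turns on whether `valueFn` is a supersolution of the Bellman equation. Fixing the
mixture `σ` that represents `valueFn` at the next state, `mixed_step_eq` splits the one-step cost
into the scalar minimax value and a remainder; nonpositivity of the remainder is `PointwiseBound`.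
Convex duality identifies this bound with the matrix inequality (`pointwiseBound_of_posSemidef`,
`posSemidef_of_pointwiseBound`). Conversely, `V̄_2 = V̄_1` at the threshold `y = |x|²_D` forces the
input `K x` and yields the bound (`pointwiseBound_of_step`).

For optimality, the supersolution bounds the cost of the saturated law by `|x₀|²_T` and every `V_k`
by `valueFn`. The matching lower bounds use the Riccati iterates from zero, which converge to `P`
exactly because `P` is the least solution. -/

noncomputable section

namespace SignGame

variable {n m : ℕ}

/-! ### Quadratic forms -/

section QuadraticForms

variable {k l : ℕ} {M N : Matrix (Fin k) (Fin k) ℝ}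

lemma dotProduct_mulVec_comm (hM : M.IsSymm) (x y : Fin k → ℝ) :
    x ⬝ᵥ (M *ᵥ y) = y ⬝ᵥ (M *ᵥ x) := by
  rw [dotProduct_mulVec, dotProduct_comm, ← mulVec_transpose, hM.eq]

lemma dotProduct_mul_mulVec (C : Matrix (Fin l) (Fin k) ℝ) (x : Fin k → ℝ) (y : Fin l → ℝ) :
    x ⬝ᵥ (Cᵀ *ᵥ y) = (C *ᵥ x) ⬝ᵥ y := by
  rw [dotProduct_mulVec, vecMul_transpose]

lemma qf_add (hM : M.IsSymm) (x y : Fin k → ℝ) :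
    qf M (x + y) = qf M x + 2 * (x ⬝ᵥ (M *ᵥ y)) + qf M y := by
  simp only [qf, mulVec_add, add_dotProduct, dotProduct_add]
  rw [dotProduct_mulVec_comm hM y x]; ring

lemma qf_smul (c : ℝ) (x : Fin k → ℝ) : qf M (c • x) = c ^ 2 * qf M x := by
  simp only [qf, mulVec_smul, smul_dotProduct, dotProduct_smul, smul_eq_mul]; ring

lemma qf_neg (x : Fin k → ℝ) : qf M (-x) = qf M x := by
  simp [qf, mulVec_neg]

lemma qf_sub (hM : M.IsSymm) (x y : Fin k → ℝ) :
    qf M (x - y) = qf M x - 2 * (x ⬝ᵥ (M *ᵥ y)) + qf M y := by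
  rw [sub_eq_add_neg, qf_add hM, qf_neg, mulVec_neg, dotProduct_neg]; ring

@[simp] lemma qf_zero (M : Matrix (Fin k) (Fin k) ℝ) : qf M 0 = 0 := by simp [qf]

lemma qf_add_matrix (x : Fin k → ℝ) : qf (M + N) x = qf M x + qf N x := by
  simp [qf, add_mulVec]

lemma qf_sub_matrix (x : Fin k → ℝ) : qf (M - N) x = qf M x - qf N x := by
  simp [qf, sub_mulVec]

lemma qf_smul_matrix (c : ℝ) (x : Fin k → ℝ) : qf (c • M) x = c * qf M x := by
  simp [qf, smul_mulVec]

lemma qf_one (x : Fin k → ℝ) : qf 1 x = x ⬝ᵥ x := by simp [qf]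

lemma qf_conj (C : Matrix (Fin k) (Fin l) ℝ) (x : Fin l → ℝ) :
    qf (Cᵀ * M * C) x = qf M (C *ᵥ x) := by
  simp only [qf, ← mulVec_mulVec, dotProduct_mul_mulVec]

lemma PosSemidef.isSymm {M : Matrix (Fin k) (Fin k) ℝ} (h : M.PosSemidef) : M.IsSymm := by
  have := h.isHermitian
  rwa [IsHermitian, conjTranspose_eq_transpose_of_trivial] at this

lemma PosSemidef.qf_nonneg {M : Matrix (Fin k) (Fin k) ℝ} (h : M.PosSemidef) (x : Fin k → ℝ) :
    0 ≤ qf M x := by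
  simpa [qf] using h.dotProduct_mulVec_nonneg x

lemma PosDef.qf_pos {M : Matrix (Fin k) (Fin k) ℝ} (h : M.PosDef) {x : Fin k → ℝ} (hx : x ≠ 0) :
    0 < qf M x := by
  simpa [qf] using h.dotProduct_mulVec_pos hx

lemma posSemidef_of_qf (hM : M.IsSymm) (h : ∀ x, 0 ≤ qf M x) : M.PosSemidef := by
  refine PosSemidef.of_dotProduct_mulVec_nonneg ?_ fun x => by simpa [qf] using h x
  rwa [IsHermitian, conjTranspose_eq_transpose_of_trivial]

lemma posDef_of_qf (hM : M.IsSymm) (h : ∀ x, x ≠ 0 → 0 < qf M x) : M.PosDef := by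
  refine PosDef.of_dotProduct_mulVec_pos ?_ fun x hx => by simpa [qf] using h x hx
  rwa [IsHermitian, conjTranspose_eq_transpose_of_trivial]

lemma eq_of_qf_eq (hM : M.IsSymm) (hN : N.IsSymm) (h : ∀ x, qf M x = qf N x) : M = N := by
  ext i j
  have h1 := h (Pi.single i 1 + Pi.single j 1)
  rw [qf_add hM, qf_add hN, h, h] at h1
  simpa using h1

lemma isSymm_conj (hM : M.IsSymm) (C : Matrix (Fin k) (Fin l) ℝ) : (Cᵀ * M * C).IsSymm := by
  simp [IsSymm, transpose_mul, hM.eq, Matrix.mul_assoc]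

lemma isSymm_inv (hM : M.IsSymm) : (M⁻¹).IsSymm := by
  rw [IsSymm, transpose_nonsing_inv, hM.eq]

lemma mulVec_inv_mulVec (hM : M.PosDef) (x : Fin k → ℝ) : M *ᵥ (M⁻¹ *ᵥ x) = x := by
  rw [mulVec_mulVec, mul_nonsing_inv _ ((isUnit_iff_isUnit_det _).1 hM.isUnit), one_mulVec]

lemma inv_mulVec_mulVec (hM : M.PosDef) (x : Fin k → ℝ) : M⁻¹ *ᵥ (M *ᵥ x) = x := by
  rw [mulVec_mulVec, nonsing_inv_mul _ ((isUnit_iff_isUnit_det _).1 hM.isUnit), one_mulVec]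

lemma qf_inv_mulVec (hM : M.PosDef) (x : Fin k → ℝ) : qf M (M⁻¹ *ᵥ x) = qf M⁻¹ x := by
  rw [qf, mulVec_inv_mulVec hM, qf, dotProduct_comm]

lemma two_mul_dotProduct_le (hM : M.PosDef) (x y : Fin k → ℝ) :
    2 * (x ⬝ᵥ y) ≤ qf M x + qf M⁻¹ y := by
  have h := hM.posSemidef
  have := PosSemidef.qf_nonneg h (x - M⁻¹ *ᵥ y)
  rw [qf_sub (PosSemidef.isSymm h), mulVec_inv_mulVec hM, qf_inv_mulVec hM] at this
  linarith

lemma continuous_qf (M : Matrix (Fin k) (Fin k) ℝ) : Continuous (qf M) := by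
  unfold qf; fun_prop

lemma continuous_qf_matrix (x : Fin k → ℝ) :
    Continuous fun M : Matrix (Fin k) (Fin k) ℝ => qf M x := by
  unfold qf; fun_prop

end QuadraticForms

/-! ### The Riccati operator -/

/-- `G = γ² I - P`. -/
def gapMatrix (γ : ℝ) (P : Matrix (Fin n) (Fin n) ℝ) : Matrix (Fin n) (Fin n) ℝ :=
  γ ^ 2 • (1 : Matrix (Fin n) (Fin n) ℝ) - P

/-- `M = γ⁴ G⁻¹ - γ² I`, so that `|p|²_M = max_v {|v|²_P - γ² |p - v|²}`. -/
def worstMatrix (γ : ℝ) (P : Matrix (Fin n) (Fin n) ℝ) : Matrix (Fin n) (Fin n) ℝ :=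
  (γ ^ 2) ^ 2 • (gapMatrix γ P)⁻¹ - γ ^ 2 • (1 : Matrix (Fin n) (Fin n) ℝ)

/-- `S = R + Bᵀ M B`. -/
def inputMatrix (B : Matrix (Fin n) (Fin m) ℝ) (R : Matrix (Fin m) (Fin m) ℝ) (γ : ℝ)
    (P : Matrix (Fin n) (Fin n) ℝ) : Matrix (Fin m) (Fin m) ℝ :=
  R + Bᵀ * worstMatrix γ P * B

/-- The gain `S⁻¹ Bᵀ M A`. -/
def gain (A : Matrix (Fin n) (Fin n) ℝ) (B : Matrix (Fin n) (Fin m) ℝ)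
    (R : Matrix (Fin m) (Fin m) ℝ) (γ : ℝ) (P : Matrix (Fin n) (Fin n) ℝ) :
    Matrix (Fin m) (Fin n) ℝ :=
  (inputMatrix B R γ P)⁻¹ * (Bᵀ * worstMatrix γ P * A)

/-- `Q + Aᵀ M A`. -/
def openLoop (A Q : Matrix (Fin n) (Fin n) ℝ) (γ : ℝ) (P : Matrix (Fin n) (Fin n) ℝ) :
    Matrix (Fin n) (Fin n) ℝ :=
  Q + Aᵀ * worstMatrix γ P * A

/-- The Riccati operator. -/
def riccatiOp (A : Matrix (Fin n) (Fin n) ℝ) (B : Matrix (Fin n) (Fin m) ℝ)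
    (Q : Matrix (Fin n) (Fin n) ℝ) (R : Matrix (Fin m) (Fin m) ℝ) (γ : ℝ)
    (P : Matrix (Fin n) (Fin n) ℝ) : Matrix (Fin n) (Fin n) ℝ :=
  openLoop A Q γ P - (gain A B R γ P)ᵀ * inputMatrix B R γ P * gain A B R γ P

/-- `0 ⪯ P ≺ γ² I`. -/
def IsAdmissible (γ : ℝ) (P : Matrix (Fin n) (Fin n) ℝ) : Prop :=
  P.PosSemidef ∧ (gapMatrix γ P).PosDef

section Riccati

variable {A : Matrix (Fin n) (Fin n) ℝ} {B : Matrix (Fin n) (Fin m) ℝ}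
  {Q : Matrix (Fin n) (Fin n) ℝ} {R : Matrix (Fin m) (Fin m) ℝ} {γ : ℝ}
  {P P' : Matrix (Fin n) (Fin n) ℝ}

lemma IsAdmissible.gap_isSymm (hP : IsAdmissible γ P) : (gapMatrix γ P).IsSymm :=
  PosSemidef.isSymm hP.2.posSemidef

lemma qf_gapMatrix (v : Fin n → ℝ) : qf (gapMatrix γ P) v = γ ^ 2 * (v ⬝ᵥ v) - qf P v := by
  rw [gapMatrix, qf_sub_matrix, qf_smul_matrix, qf_one]

lemma qf_worstMatrix (p : Fin n → ℝ) :
    qf (worstMatrix γ P) p = (γ ^ 2) ^ 2 * qf (gapMatrix γ P)⁻¹ p - γ ^ 2 * (p ⬝ᵥ p) := by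
  rw [worstMatrix, qf_sub_matrix, qf_smul_matrix, qf_smul_matrix, qf_one]

lemma IsAdmissible.worst_isSymm (hP : IsAdmissible γ P) : (worstMatrix γ P).IsSymm := by
  have h := (isSymm_inv hP.gap_isSymm).eq
  simp [IsSymm, worstMatrix, h]

lemma dotProduct_sub_self (p v : Fin n → ℝ) :
    (p - v) ⬝ᵥ (p - v) = p ⬝ᵥ p - 2 * (p ⬝ᵥ v) + v ⬝ᵥ v := by
  simp only [sub_dotProduct, dotProduct_sub]; rw [dotProduct_comm v p]; ring

/-- Completion of the square in the disturbance. -/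
lemma disturbance_square (hP : IsAdmissible γ P) (p v : Fin n → ℝ) :
    qf P v - γ ^ 2 * ((p - v) ⬝ᵥ (p - v)) = qf (worstMatrix γ P) p
      - qf (gapMatrix γ P) (v - γ ^ 2 • ((gapMatrix γ P)⁻¹ *ᵥ p)) := by
  rw [qf_sub hP.gap_isSymm, mulVec_smul, mulVec_inv_mulVec hP.2, qf_smul, qf_inv_mulVec hP.2,
    qf_worstMatrix, qf_gapMatrix, dotProduct_sub_self, dotProduct_smul, dotProduct_comm v p,
    smul_eq_mul]
  ring

lemma disturbance_le (hP : IsAdmissible γ P) (p v : Fin n → ℝ) :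
    qf P v - γ ^ 2 * ((p - v) ⬝ᵥ (p - v)) ≤ qf (worstMatrix γ P) p := by
  rw [disturbance_square hP]
  linarith [PosSemidef.qf_nonneg hP.2.posSemidef (v - γ ^ 2 • ((gapMatrix γ P)⁻¹ *ᵥ p))]

lemma exists_worst_disturbance (hP : IsAdmissible γ P) (p : Fin n → ℝ) :
    ∃ v, qf P v - γ ^ 2 * ((p - v) ⬝ᵥ (p - v)) = qf (worstMatrix γ P) p :=
  ⟨γ ^ 2 • ((gapMatrix γ P)⁻¹ *ᵥ p), by rw [disturbance_square hP, sub_self, qf_zero, sub_zero]⟩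

lemma IsAdmissible.qf_worst_nonneg (hP : IsAdmissible γ P) (p : Fin n → ℝ) :
    0 ≤ qf (worstMatrix γ P) p := by
  have := disturbance_le hP p p
  simp only [sub_self, zero_dotProduct, mul_zero, sub_zero] at this
  exact (PosSemidef.qf_nonneg hP.1 p).trans this

lemma qf_worst_mono (hP : IsAdmissible γ P) (hP' : IsAdmissible γ P')
    (h : ∀ x, qf P x ≤ qf P' x) (p : Fin n → ℝ) :
    qf (worstMatrix γ P) p ≤ qf (worstMatrix γ P') p := by
  obtain ⟨v, hv⟩ := exists_worst_disturbance hP p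
  linarith [h v, disturbance_le hP' p v]

lemma IsAdmissible.input_posDef (hP : IsAdmissible γ P) (hR : R.PosDef) :
    (inputMatrix B R γ P).PosDef := by
  refine posDef_of_qf ?_ fun u hu => ?_
  · exact (PosSemidef.isSymm hR.posSemidef).add (isSymm_conj hP.worst_isSymm B)
  · rw [inputMatrix, qf_add_matrix, qf_conj]
    linarith [PosDef.qf_pos hR hu, hP.qf_worst_nonneg (B *ᵥ u)]

lemma IsAdmissible.openLoop_isSymm (hP : IsAdmissible γ P) (hQ : Q.PosDef) :
    (openLoop A Q γ P).IsSymm :=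
  (PosSemidef.isSymm hQ.posSemidef).add (isSymm_conj hP.worst_isSymm A)

lemma IsAdmissible.riccatiOp_isSymm (hP : IsAdmissible γ P) (hQ : Q.PosDef) (hR : R.PosDef) :
    (riccatiOp A B Q R γ P).IsSymm :=
  (hP.openLoop_isSymm hQ).sub
    (isSymm_conj (PosSemidef.isSymm (hP.input_posDef hR).posSemidef) _)

lemma qf_openLoop (x : Fin n → ℝ) :
    qf (openLoop A Q γ P) x = qf Q x + qf (worstMatrix γ P) (A *ᵥ x) := by
  rw [openLoop, qf_add_matrix, qf_conj]

lemma qf_inputMatrix (u : Fin m → ℝ) :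
    qf (inputMatrix B R γ P) u = qf R u + qf (worstMatrix γ P) (B *ᵥ u) := by
  rw [inputMatrix, qf_add_matrix, qf_conj]

lemma qf_riccatiOp (x : Fin n → ℝ) :
    qf (riccatiOp A B Q R γ P) x = qf (openLoop A Q γ P) x
      - qf (inputMatrix B R γ P) (gain A B R γ P *ᵥ x) := by
  rw [riccatiOp, qf_sub_matrix, qf_conj]

lemma IsAdmissible.input_mulVec_gain (hP : IsAdmissible γ P) (hR : R.PosDef) (x : Fin n → ℝ) :
    inputMatrix B R γ P *ᵥ (gain A B R γ P *ᵥ x)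
      = Bᵀ *ᵥ (worstMatrix γ P *ᵥ (A *ᵥ x)) := by
  rw [gain, ← mulVec_mulVec, mulVec_inv_mulVec (hP.input_posDef hR), mulVec_mulVec,
    mulVec_mulVec, Matrix.mul_assoc]

/-- Completion of the square in the input. -/
lemma input_square (hP : IsAdmissible γ P) (hR : R.PosDef) (x : Fin n → ℝ) (u : Fin m → ℝ) :
    qf Q x + qf R u + qf (worstMatrix γ P) (A *ᵥ x + B *ᵥ u)
      = qf (riccatiOp A B Q R γ P) x
        + qf (inputMatrix B R γ P) (u + gain A B R γ P *ᵥ x) := by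
  rw [qf_add (PosSemidef.isSymm (hP.input_posDef hR).posSemidef), qf_add hP.worst_isSymm,
    hP.input_mulVec_gain hR, dotProduct_mul_mulVec, qf_riccatiOp, qf_openLoop,
    qf_inputMatrix u, dotProduct_mulVec_comm hP.worst_isSymm (A *ᵥ x)]
  ring

lemma riccatiMax_eq (hP : IsAdmissible γ P) (hR : R.PosDef) (x : Fin n → ℝ) (u : Fin m → ℝ) :
    riccatiMax A B Q R γ P x u = ((qf (riccatiOp A B Q R γ P) x
        + qf (inputMatrix B R γ P) (u + gain A B R γ P *ᵥ x) : ℝ) : EReal) := by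
  rw [← input_square hP hR]
  apply le_antisymm
  · refine iSup_le fun v => EReal.coe_le_coe_iff.2 ?_
    linarith [disturbance_le hP (A *ᵥ x + B *ᵥ u) v]
  · obtain ⟨v, hv⟩ := exists_worst_disturbance hP (A *ᵥ x + B *ᵥ u)
    refine le_iSup_of_le v (EReal.coe_le_coe_iff.2 ?_)
    linarith

lemma iInf_riccatiMax (hP : IsAdmissible γ P) (hR : R.PosDef) (x : Fin n → ℝ) :
    ⨅ u, riccatiMax A B Q R γ P x u = ((qf (riccatiOp A B Q R γ P) x : ℝ) : EReal) := by
  apply le_antisymm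
  · refine iInf_le_of_le (-(gain A B R γ P *ᵥ x)) ?_
    rw [riccatiMax_eq hP hR]; simp
  · refine le_iInf fun u => ?_
    rw [riccatiMax_eq hP hR, EReal.coe_le_coe_iff]
    linarith [PosSemidef.qf_nonneg (hP.input_posDef (B := B) hR).posSemidef
      (u + gain A B R γ P *ᵥ x)]

lemma IsRiccatiSolution.isAdmissible (h : IsRiccatiSolution A B Q R γ P) : IsAdmissible γ P :=
  ⟨h.1.posSemidef, h.2.1⟩

lemma IsRiccatiSolution.riccatiOp_eq (h : IsRiccatiSolution A B Q R γ P) (hQ : Q.PosDef)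
    (hR : R.PosDef) : riccatiOp A B Q R γ P = P := by
  refine eq_of_qf_eq (h.isAdmissible.riccatiOp_isSymm hQ hR) (PosSemidef.isSymm h.1.posSemidef)
    fun x => ?_
  have := h.2.2 x
  rw [iInf_riccatiMax h.isAdmissible hR, EReal.coe_eq_coe_iff] at this
  exact this.symm

/-- `S` is positive definite, so the minimizing input is unique for each `x`. -/
lemma IsRiccatiGain.eq_gain {K : Matrix (Fin m) (Fin n) ℝ} (h : IsRiccatiGain A B Q R γ P K)
    (hP : IsAdmissible γ P) (hR : R.PosDef) : K = gain A B R γ P := by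
  refine ext_of_mulVec_single fun i => ?_
  generalize (Pi.single i 1 : Fin n → ℝ) = x
  have h1 := h x (-(gain A B R γ P *ᵥ x))
  rw [riccatiMax_eq hP hR, riccatiMax_eq hP hR, EReal.coe_le_coe_iff, neg_add_cancel, qf_zero]
    at h1
  by_contra hne
  have h2 : -(K *ᵥ x) + gain A B R γ P *ᵥ x ≠ 0 := fun h0 => hne (by
    rw [neg_add_eq_zero] at h0; exact h0)
  linarith [PosDef.qf_pos (hP.input_posDef (B := B) hR) h2]

/-- `M = γ² P G⁻¹`, and `(P⁻¹ - γ⁻² I) γ² P = G`; hence `M` inverts `P⁻¹ - γ⁻² I`. -/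
lemma Tmat_eq_openLoop (hγ : 0 < γ) (hP : P.PosDef) (hG : (gapMatrix γ P).PosDef) :
    Tmat A Q γ P = openLoop A Q γ P := by
  have hPu := (isUnit_iff_isUnit_det _).1 hP.isUnit
  have hGu := (isUnit_iff_isUnit_det _).1 hG.isUnit
  have hγ2 : γ ^ 2 ≠ 0 := by positivity
  have h1 : worstMatrix γ P = γ ^ 2 • (P * (gapMatrix γ P)⁻¹) := by
    have h : P * (gapMatrix γ P)⁻¹ = γ ^ 2 • (gapMatrix γ P)⁻¹ - 1 := by
      have : (γ ^ 2 • (1 : Matrix (Fin n) (Fin n) ℝ) - gapMatrix γ P) * (gapMatrix γ P)⁻¹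
          = γ ^ 2 • (gapMatrix γ P)⁻¹ - 1 := by
        rw [Matrix.sub_mul, mul_nonsing_inv _ hGu, Matrix.smul_mul, Matrix.one_mul]
      rwa [gapMatrix, sub_sub_cancel] at this
    rw [h, worstMatrix, smul_sub, smul_smul, sq (γ ^ 2)]
  have h2 : (P⁻¹ - (γ ^ 2)⁻¹ • (1 : Matrix (Fin n) (Fin n) ℝ)) * worstMatrix γ P = 1 := by
    rw [h1, Matrix.mul_smul, ← Matrix.mul_assoc, Matrix.sub_mul, nonsing_inv_mul _ hPu,
      ← Matrix.smul_mul, smul_sub, Matrix.smul_mul, Matrix.one_mul, smul_smul,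
      mul_inv_cancel₀ hγ2, one_smul]
    exact mul_nonsing_inv _ hGu
  rw [Tmat, openLoop, inv_eq_right_inv h2]

end Riccati

/-! ### The scalar minimax problem -/

/-- `max_{|σ| ≤ 1} {(1 - σ²) d + 2 σ y}`. -/
def satValue (d y : ℝ) : ℝ := if d ≤ |y| then 2 * |y| else d + y ^ 2 / d

lemma le_satValue {d y σ : ℝ} (hd : 0 ≤ d) (h1 : -1 ≤ σ) (h2 : σ ≤ 1) :
    (1 - σ ^ 2) * d + 2 * σ * y ≤ satValue d y := by
  have hσ : |σ| ≤ 1 := abs_le.2 ⟨h1, h2⟩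
  have h3 : σ * y ≤ |σ| * |y| := by rw [← abs_mul]; exact le_abs_self _
  unfold satValue
  split_ifs with h
  · have h4 : (1 - σ ^ 2) * d ≤ (1 - σ ^ 2) * |y| := by
      apply mul_le_mul_of_nonneg_left h; nlinarith
    have h5 : (1 - |σ|) ^ 2 * |y| ≥ 0 := by positivity
    have : |σ| ^ 2 = σ ^ 2 := sq_abs σ
    nlinarith
  · have hd' : 0 < d := by push Not at h; exact (abs_nonneg y).trans_lt h
    have h4 : 0 ≤ (y - σ * d) ^ 2 / d := by positivity
    have h5 : (y - σ * d) ^ 2 / d = y ^ 2 / d - 2 * σ * y + σ ^ 2 * d := by field_simp; ring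
    linarith

lemma exists_eq_satValue (d y : ℝ) :
    ∃ σ : ℝ, -1 ≤ σ ∧ σ ≤ 1 ∧ (1 - σ ^ 2) * d + 2 * σ * y = satValue d y := by
  unfold satValue
  split_ifs with h
  · rcases abs_cases y with ⟨hy, _⟩ | ⟨hy, _⟩
    · exact ⟨1, by norm_num, by norm_num, by rw [hy]; ring⟩
    · exact ⟨-1, by norm_num, by norm_num, by rw [hy]; ring⟩
  · push Not at h
    have hd' : 0 < d := (abs_nonneg y).trans_lt h
    obtain ⟨h1, h2⟩ := abs_lt.1 h
    refine ⟨y / d, ?_, ?_, ?_⟩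
    · rw [le_div_iff₀ hd']; linarith
    · rw [div_le_iff₀ hd']; linarith
    · field_simp; ring

lemma neg_one_le_sat (t : ℝ) : -1 ≤ sat t := by unfold sat; split_ifs <;> linarith

lemma sat_le_one (t : ℝ) : sat t ≤ 1 := by unfold sat; split_ifs <;> linarith

/-- The dual side of the scalar minimax: `d + θ² d + 2 |y - θ d|` evaluated at the saddle point `θ =
sat (y / d)`. For `d = 0` the convention `y / 0 = 0` gives `θ = 0`, and both sides are `2 |y|`. -/
lemma satValue_eq_sat {d : ℝ} (y : ℝ) (hd : 0 ≤ d) :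
    satValue d y = d + sat (y / d) ^ 2 * d + 2 * |y - sat (y / d) * d| := by
  rcases hd.eq_or_lt with rfl | hd
  · simp [satValue]
  unfold satValue sat
  simp only [one_lt_div hd, div_lt_iff₀ hd]
  split_ifs with h h1 h2 h1 h2
  · rw [abs_of_pos (by linarith), abs_of_pos (by linarith)]; ring
  · rw [abs_of_neg (by linarith), abs_of_neg (by linarith)]; ring
  · push Not at h1 h2
    rcases le_abs'.1 h with h3 | h3
    · have : y = -d := by linarith
      subst this
      rw [neg_div, div_self hd.ne']
      simp [abs_of_pos hd]; ring
    · have : y = d := by linarith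
      subst this
      rw [div_self hd.ne']
      simp [abs_of_pos hd]; ring
  · exact absurd (h1.le.trans (le_abs_self y)) h
  · push Not at h
    linarith [neg_abs_le y]
  · rw [div_mul_cancel₀ _ hd.ne', sub_self, abs_zero]; field_simp; ring

/-! ### The matrix inequality -/

section Key

variable {A : Matrix (Fin n) (Fin n) ℝ} {B : Matrix (Fin n) (Fin m) ℝ}
  {Q : Matrix (Fin n) (Fin n) ℝ} {R : Matrix (Fin m) (Fin m) ℝ} {γ : ℝ}
  {P : Matrix (Fin n) (Fin n) ℝ}

/-- The quadratic form of `(1 + ε F) G (1 + ε F)ᵀ`. -/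
lemma qf_one_add_smul_conj {G : Matrix (Fin n) (Fin n) ℝ} (hG : G.IsSymm)
    (F : Matrix (Fin n) (Fin n) ℝ) (ε : ℝ) (ζ : Fin n → ℝ) :
    qf ((1 + ε • F) * G * (1 + ε • F)ᵀ) ζ
      = qf G ζ + 2 * ε * (ζ ⬝ᵥ (G *ᵥ (Fᵀ *ᵥ ζ))) + ε ^ 2 * qf G (Fᵀ *ᵥ ζ) := by
  have := qf_conj (M := G) (1 + ε • F)ᵀ ζ
  rw [transpose_transpose] at this
  rw [this, transpose_add, transpose_one, transpose_smul, add_mulVec, one_mulVec, smul_mulVec,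
    qf_add hG, qf_smul, mulVec_smul, dotProduct_smul, smul_eq_mul]
  ring

/-- The pointwise inequality that the matrix inequality encodes: `z` stands for `A x` and
`F z` for `B K x`. -/
def PointwiseBound (G D F : Matrix (Fin n) (Fin n) ℝ) (θ σ : ℝ) : Prop :=
  ∀ a v z : Fin n → ℝ, G *ᵥ a = z → ∀ p, G *ᵥ p = θ • (F *ᵥ z) - σ • z →
    (1 - σ ^ 2) * (qf D v - qf G a) ≤ qf G (v - p)

lemma pointwiseBound_of_posSemidef {G D F : Matrix (Fin n) (Fin n) ℝ} (hG : G.PosDef)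
    (hD : D.PosDef)
    (h : ∀ ε : ℝ, ε = 1 ∨ ε = -1 →
      (G * D⁻¹ * G - (1 + ε • F) * G * (1 + ε • F)ᵀ).PosSemidef)
    {θ σ : ℝ} (hθ1 : -1 ≤ θ) (hθ2 : θ ≤ 1) (hσ1 : -1 ≤ σ) (hσ2 : σ ≤ 1) :
    PointwiseBound G D F θ σ := by
  intro a v z ha p hp
  have hGs := PosSemidef.isSymm hG.posSemidef
  -- With this test vector the left-hand form `G D⁻¹ G` becomes `|v|²_D`.
  set ζ := G⁻¹ *ᵥ (D *ᵥ v) with hζ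
  have hGζ : G *ᵥ ζ = D *ᵥ v := mulVec_inv_mulVec hG _
  have hD1 : qf (G * D⁻¹ * G) ζ = qf D v := by
    have := qf_conj (M := D⁻¹) G ζ
    rw [hGs.eq] at this
    rw [this, hGζ, qf, inv_mulVec_mulVec hD, dotProduct_comm, qf]
  have hε : ∀ ε : ℝ, ε = 1 ∨ ε = -1 → qf G ζ + 2 * ε * (ζ ⬝ᵥ (G *ᵥ (Fᵀ *ᵥ ζ)))
      + ε ^ 2 * qf G (Fᵀ *ᵥ ζ) ≤ qf D v := fun ε hε => by
    have := PosSemidef.qf_nonneg (h ε hε) ζ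
    rw [qf_sub_matrix, qf_one_add_smul_conj hGs, hD1] at this
    linarith
  have hp1 := hε 1 (Or.inl rfl)
  have hp2 := hε (-1) (Or.inr rfl)
  set s := ζ ⬝ᵥ (G *ᵥ (Fᵀ *ᵥ ζ)) with hs
  have hf := PosSemidef.qf_nonneg hG.posSemidef (Fᵀ *ᵥ ζ)
  set f := qf G (Fᵀ *ᵥ ζ) with hfdef
  set η := θ • (Fᵀ *ᵥ ζ) - σ • ζ with hη
  have hηq : qf G η = θ ^ 2 * f - 2 * (θ * σ) * s + σ ^ 2 * qf G ζ := by
    rw [hη, qf_sub hGs, qf_smul, qf_smul, mulVec_smul, smul_dotProduct, dotProduct_smul,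
      dotProduct_mulVec_comm hGs, smul_eq_mul, smul_eq_mul]
    ring
  -- The left side is `|ζ|² + θ² f - 2 θ σ s`, at most `|ζ|² + f + 2 |s|`; the sign of `s` decides
  -- which of the two matrix inequalities is used.
  have hbound : (1 - σ ^ 2) * qf G ζ + qf G η ≤ qf D v := by
    have h1 : θ ^ 2 * f ≤ f := by
      have : θ ^ 2 ≤ 1 := by nlinarith
      nlinarith
    have h2 : -(2 * (θ * σ) * s) ≤ 2 * |s| := by
      have h3 : |θ * σ| ≤ 1 := by
        rw [abs_mul]
        exact mul_le_one₀ (abs_le.2 ⟨hθ1, hθ2⟩) (abs_nonneg _) (abs_le.2 ⟨hσ1, hσ2⟩)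
      have h4 : -((θ * σ) * s) ≤ |θ * σ| * |s| := by rw [← abs_mul]; exact neg_le_abs _
      have h5 : |θ * σ| * |s| ≤ |s| := mul_le_of_le_one_left (abs_nonneg _) h3
      linarith
    rw [hηq]
    rcases abs_cases s with ⟨h3, _⟩ | ⟨h3, _⟩ <;> rw [h3] at h2 <;> nlinarith
  have hτ : 0 ≤ 1 - σ ^ 2 := by nlinarith
  have hy1 := PosSemidef.qf_nonneg hG.posSemidef ((v - p) - (1 - σ ^ 2) • ζ)
  rw [qf_sub hGs, mulVec_smul, hGζ, qf_smul, dotProduct_smul, smul_eq_mul] at hy1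
  have hy2 := PosSemidef.qf_nonneg hG.posSemidef (η - a)
  rw [qf_sub hGs, ha] at hy2
  have hcross : p ⬝ᵥ (D *ᵥ v) = η ⬝ᵥ z := by
    rw [← hGζ, dotProduct_mulVec_comm hGs, hp, hη, dotProduct_comm]
    simp only [sub_dotProduct, smul_dotProduct]
    rw [dotProduct_comm (Fᵀ *ᵥ ζ), dotProduct_mul_mulVec, dotProduct_comm z]
  have hvD : qf D v = (v - p) ⬝ᵥ (D *ᵥ v) + η ⬝ᵥ z := by
    rw [← hcross, sub_dotProduct, qf]; ring
  -- With `τ = 1 - σ²`, the square in `v - p` plus `τ` times the square in `η - a` gives `|v - p|²_G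
  -- + τ |a|²_G ≥ 2 τ |v|²_D - τ (τ |ζ|²_G + |η|²_G)`, and `hbound` controls the last bracket.
  nlinarith [mul_le_mul_of_nonneg_left hbound hτ, mul_nonneg hτ hy2]

lemma le_of_forall_lt_one {a b X : ℝ} (h : ∀ σ : ℝ, -1 < σ → σ < 1 → a + σ * b ≤ X) :
    a + b ≤ X := by
  by_contra! hX
  have hb : 0 < b := by linarith [h 0 (by norm_num) (by norm_num)]
  obtain ⟨t, ht1, ht2⟩ : ∃ t : ℝ, max (-1) ((X - a) / b) < t ∧ t < 1 :=
    exists_between (max_lt (by norm_num) (by rw [div_lt_one hb]; linarith))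
  have h1 := h t ((le_max_left _ _).trans_lt ht1) ht2
  have h2 := (le_max_right _ _).trans_lt ht1
  rw [div_lt_iff₀ hb] at h2
  linarith

/-- Run the duality backwards with `a` and `v` chosen so that both squares of the forward argument
vanish. Cancelling a factor `1 - σ²` needs `|σ| < 1`; the endpoints follow by a limit. -/
lemma posSemidef_of_pointwiseBound {G D F : Matrix (Fin n) (Fin n) ℝ} (hG : G.PosDef)
    (hD : D.PosDef) (h : ∀ σ : ℝ, -1 < σ → σ < 1 → PointwiseBound G D F 1 σ)
    (ε : ℝ) (hε : ε = 1 ∨ ε = -1) :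
    (G * D⁻¹ * G - (1 + ε • F) * G * (1 + ε • F)ᵀ).PosSemidef := by
  have hGs := PosSemidef.isSymm hG.posSemidef
  have hDs := isSymm_inv (PosSemidef.isSymm hD.posSemidef)
  refine posSemidef_of_qf ?_ fun ζ => ?_
  · have h1 := isSymm_conj hDs G
    have h2 := isSymm_conj hGs (1 + ε • F)ᵀ
    rw [hGs.eq] at h1
    rw [transpose_transpose] at h2
    exact h1.sub h2
  rw [qf_sub_matrix, qf_one_add_smul_conj hGs, sub_nonneg]
  have hD1 : qf (G * D⁻¹ * G) ζ = qf D⁻¹ (G *ᵥ ζ) := by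
    have := qf_conj (M := D⁻¹) G ζ
    rwa [hGs.eq] at this
  rw [hD1]
  set s := ζ ⬝ᵥ (G *ᵥ (Fᵀ *ᵥ ζ)) with hs
  set f := qf G (Fᵀ *ᵥ ζ) with hfdef
  have main : ∀ σ : ℝ, -1 < σ → σ < 1 →
      qf G ζ + f - 2 * σ * s ≤ qf D⁻¹ (G *ᵥ ζ) := by
    intro σ hσ1 hσ2
    have hτ : 0 < 1 - σ ^ 2 := by nlinarith
    set η := Fᵀ *ᵥ ζ - σ • ζ with hη
    have hηq : qf G η = f - 2 * σ * s + σ ^ 2 * qf G ζ := by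
      rw [hη, qf_sub hGs, qf_smul, mulVec_smul, dotProduct_smul,
        dotProduct_mulVec_comm hGs, smul_eq_mul]
      ring
    set p := G⁻¹ *ᵥ (F *ᵥ (G *ᵥ η) - σ • (G *ᵥ η)) with hpdef
    have hp : G *ᵥ p = F *ᵥ (G *ᵥ η) - σ • (G *ᵥ η) := mulVec_inv_mulVec hG _
    have h1 := h σ hσ1 hσ2 η (p + (1 - σ ^ 2) • ζ) (G *ᵥ η) rfl p (by rw [one_smul, hp])
    rw [add_sub_cancel_left, qf_smul, sq (1 - σ ^ 2), mul_assoc] at h1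
    have h2 := le_of_mul_le_mul_left h1 hτ
    -- Fenchel's inequality for `D` replaces the specific `v` by the dual norm of `G ζ`.
    have h3 := two_mul_dotProduct_le hD (p + (1 - σ ^ 2) • ζ) (G *ᵥ ζ)
    have h4 : (p + (1 - σ ^ 2) • ζ) ⬝ᵥ (G *ᵥ ζ) = qf G η + (1 - σ ^ 2) * qf G ζ := by
      rw [add_dotProduct, smul_dotProduct, dotProduct_mulVec_comm hGs p, hp, dotProduct_sub,
        dotProduct_smul, dotProduct_comm ζ (F *ᵥ _), ← dotProduct_mul_mulVec,
        dotProduct_comm _ (Fᵀ *ᵥ ζ), smul_eq_mul, smul_eq_mul]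
      have : qf G η = (Fᵀ *ᵥ ζ) ⬝ᵥ (G *ᵥ η) - σ * (ζ ⬝ᵥ (G *ᵥ η)) := by
        conv_lhs => rw [qf, hη]
        rw [sub_dotProduct, smul_dotProduct, smul_eq_mul]
      rw [this]
      rfl
    rw [h4] at h3
    nlinarith
  rcases hε with rfl | rfl
  · have := le_of_forall_lt_one (a := qf G ζ + f) (b := 2 * s) (X := qf D⁻¹ (G *ᵥ ζ))
      fun σ h1 h2 => by linarith [main (-σ) (by linarith) (by linarith)]
    linarith
  · have := le_of_forall_lt_one (a := qf G ζ + f) (b := -2 * s) (X := qf D⁻¹ (G *ᵥ ζ))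
      fun σ h1 h2 => by linarith [main σ h1 h2]
    linarith

end Key

/-! ### One step of the game -/

/-- The part of the stage cost that does not depend on the sign. -/
def stage (A : Matrix (Fin n) (Fin n) ℝ) (B : Matrix (Fin n) (Fin m) ℝ)
    (Q : Matrix (Fin n) (Fin n) ℝ) (R : Matrix (Fin m) (Fin m) ℝ) (γ : ℝ)
    (x : Fin n → ℝ) (u : Fin m → ℝ) (v : Fin n → ℝ) : ℝ :=
  qf Q x + qf R u - γ ^ 2 * ((B *ᵥ u - v) ⬝ᵥ (B *ᵥ u - v)) - γ ^ 2 * ((A *ᵥ x) ⬝ᵥ (A *ᵥ x))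

/-- The increment of `⟨A, Y⟩` in one step. -/
def corr (A : Matrix (Fin n) (Fin n) ℝ) (B : Matrix (Fin n) (Fin m) ℝ) (γ : ℝ)
    (x : Fin n → ℝ) (u : Fin m → ℝ) (v : Fin n → ℝ) : ℝ :=
  γ ^ 2 * ((B *ᵥ u - v) ⬝ᵥ (A *ᵥ x))

/-- The value function in terms of `x` and `y = ⟨A, Y⟩`, up to a term that depends on `Z` only. -/
def valueFn (A Q : Matrix (Fin n) (Fin n) ℝ) (γ : ℝ) (P : Matrix (Fin n) (Fin n) ℝ)
    (x : Fin n → ℝ) (y : ℝ) : ℝ :=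
  qf P x + satValue (qf (openLoop A Q γ P - P) x) y

section Step

variable {A : Matrix (Fin n) (Fin n) ℝ} {B : Matrix (Fin n) (Fin m) ℝ}
  {Q : Matrix (Fin n) (Fin n) ℝ} {R : Matrix (Fin m) (Fin m) ℝ} {γ : ℝ}
  {P : Matrix (Fin n) (Fin n) ℝ}

lemma stage_add_corr (x v : Fin n → ℝ) (u : Fin m → ℝ) (σ : ℝ) :
    stage A B Q R γ x u v + 2 * σ * corr A B γ x u v = qf Q x + qf R u
      - γ ^ 2 * ((B *ᵥ u - σ • (A *ᵥ x) - v) ⬝ᵥ (B *ᵥ u - σ • (A *ᵥ x) - v))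
      - γ ^ 2 * (1 - σ ^ 2) * ((A *ᵥ x) ⬝ᵥ (A *ᵥ x)) := by
  rw [show B *ᵥ u - σ • (A *ᵥ x) - v = (B *ᵥ u - v) - σ • (A *ᵥ x) by abel,
    dotProduct_sub_self (B *ᵥ u - v), stage, corr]
  simp only [smul_dotProduct, dotProduct_smul, smul_eq_mul]
  ring

lemma qf_sign_smul {k : ℕ} {M : Matrix (Fin k) (Fin k) ℝ} {i : ℝ} (hi : i = 1 ∨ i = -1)
    (x : Fin k → ℝ) : qf M (i • x) = qf M x := by
  rw [qf_smul]; rcases hi with rfl | rfl <;> norm_num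

/-- With the sign known, the worst disturbance costs the Riccati value plus a square. -/
lemma exists_worst_next (hP : IsAdmissible γ P) (hR : R.PosDef) (x : Fin n → ℝ) (u : Fin m → ℝ)
    {i : ℝ} (hi : i = 1 ∨ i = -1) :
    ∃ v, stage A B Q R γ x u v + 2 * i * corr A B γ x u v + qf P v
      = qf (riccatiOp A B Q R γ P) x
        + qf (inputMatrix B R γ P) (u - i • (gain A B R γ P *ᵥ x)) := by
  obtain ⟨v, hv⟩ := exists_worst_disturbance hP (B *ᵥ u - i • (A *ᵥ x))
  have h1 := input_square (A := A) (B := B) (Q := Q) hP hR (-(i • x)) u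
  rw [qf_neg, qf_neg, qf_sign_smul hi, qf_sign_smul hi, mulVec_neg, mulVec_neg, mulVec_smul,
    mulVec_smul, neg_add_eq_sub, ← sub_eq_add_neg] at h1
  refine ⟨v, ?_⟩
  have hi2 : 1 - i ^ 2 = 0 := by rcases hi with rfl | rfl <;> norm_num
  rw [stage_add_corr, hi2]
  linarith

/-- Give the signs `±1` the weights `(1 ± σ)/2`. The squares `|u ∓ K x|²_S` average to `|u - σ K
x|²_S + (1 - σ²) |K x|²_S`, and the first term is dropped. One of the two signs does at least as
well as the average. -/
lemma exists_next_ge (hP : IsAdmissible γ P) (hR : R.PosDef) (x : Fin n → ℝ) (u : Fin m → ℝ)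
    (y : ℝ) {σ : ℝ} (h1 : -1 ≤ σ) (h2 : σ ≤ 1) :
    ∃ v, ∃ i : ℝ, (i = 1 ∨ i = -1) ∧
      qf (openLoop A Q γ P) x
        - σ ^ 2 * (qf (openLoop A Q γ P) x - qf (riccatiOp A B Q R γ P) x) + 2 * σ * y
      ≤ stage A B Q R γ x u v + qf P v + 2 * i * (y + corr A B γ x u v) := by
  have hS := PosSemidef.isSymm (hP.input_posDef (B := B) hR).posSemidef
  obtain ⟨v1, hv1⟩ := exists_worst_next (A := A) (B := B) (Q := Q) hP hR x u (Or.inl rfl)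
  obtain ⟨v2, hv2⟩ := exists_worst_next (A := A) (B := B) (Q := Q) hP hR x u (Or.inr rfl)
  rw [qf_sub hS, qf_smul, mulVec_smul, dotProduct_smul, smul_eq_mul] at hv1 hv2
  have h3 := PosSemidef.qf_nonneg (hP.input_posDef (B := B) hR).posSemidef
    (u - σ • (gain A B R γ P *ᵥ x))
  rw [qf_sub hS, qf_smul, mulVec_smul, dotProduct_smul, smul_eq_mul] at h3
  have h4 := qf_riccatiOp (A := A) (B := B) (Q := Q) (R := R) (γ := γ) (P := P) x
  by_contra! hcon
  have c1 := hcon v1 1 (Or.inl rfl)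
  have c2 := hcon v2 (-1) (Or.inr rfl)
  -- At `σ = -1` the sign `+1` has weight zero, so strictness must come from the other sign.
  rcases h1.eq_or_lt with rfl | h1
  · nlinarith
  · nlinarith [mul_lt_mul_of_pos_left c1 (show 0 < 1 + σ by linarith),
      mul_le_mul_of_nonneg_left c2.le (show 0 ≤ 1 - σ by linarith)]

lemma exists_next_ge_abs (hP : IsAdmissible γ P) (hR : R.PosDef) (x : Fin n → ℝ)
    (u : Fin m → ℝ) (y : ℝ) {σ : ℝ} (h1 : -1 ≤ σ) (h2 : σ ≤ 1) :
    ∃ v, qf (openLoop A Q γ P) x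
        - σ ^ 2 * (qf (openLoop A Q γ P) x - qf (riccatiOp A B Q R γ P) x) + 2 * σ * y
      ≤ stage A B Q R γ x u v + (qf P v + 2 * |y + corr A B γ x u v|) := by
  obtain ⟨v, i, hi, h⟩ := exists_next_ge (A := A) (B := B) (Q := Q) hP hR x u y h1 h2
  refine ⟨v, h.trans ?_⟩
  rcases hi with rfl | rfl
  · linarith [le_abs_self (y + corr A B γ x u v)]
  · linarith [neg_le_abs (y + corr A B γ x u v)]

lemma exists_next_ge_riccati (hP : IsAdmissible γ P) (hR : R.PosDef) (x : Fin n → ℝ)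
    (u : Fin m → ℝ) (y : ℝ) :
    ∃ v, qf (riccatiOp A B Q R γ P) x + 2 * |y|
      ≤ stage A B Q R γ x u v + (qf P v + 2 * |y + corr A B γ x u v|) := by
  rcases abs_cases y with ⟨hy, _⟩ | ⟨hy, _⟩
  · obtain ⟨v, hv⟩ := exists_next_ge_abs (A := A) (B := B) (Q := Q) hP hR x u y (σ := 1)
      (by norm_num) le_rfl
    exact ⟨v, by rw [hy]; linarith⟩
  · obtain ⟨v, hv⟩ := exists_next_ge_abs (A := A) (B := B) (Q := Q) hP hR x u y (σ := -1)
      le_rfl (by norm_num)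
    exact ⟨v, by rw [hy]; linarith⟩

lemma qf_openLoop_sub (hRic : riccatiOp A B Q R γ P = P) (x : Fin n → ℝ) :
    qf (openLoop A Q γ P - P) x = qf (inputMatrix B R γ P) (gain A B R γ P *ᵥ x) := by
  have := qf_riccatiOp (A := A) (B := B) (Q := Q) (R := R) (γ := γ) (P := P) x
  rw [hRic] at this
  rw [qf_sub_matrix]; linarith

lemma qf_openLoop_sub_nonneg (hP : IsAdmissible γ P) (hR : R.PosDef)
    (hRic : riccatiOp A B Q R γ P = P) (x : Fin n → ℝ) : 0 ≤ qf (openLoop A Q γ P - P) x := by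
  rw [qf_openLoop_sub hRic]
  exact PosSemidef.qf_nonneg (hP.input_posDef hR).posSemidef _

lemma openLoop_sub_posDef (hP : IsAdmissible γ P) (hQ : Q.PosDef) (hR : R.PosDef)
    (hRic : riccatiOp A B Q R γ P = P) (hu : IsUnit (openLoop A Q γ P - P)) :
    (openLoop A Q γ P - P).PosDef := by
  have hs := posSemidef_of_qf ((hP.openLoop_isSymm (A := A) hQ).sub (PosSemidef.isSymm hP.1))
    (qf_openLoop_sub_nonneg hP hR hRic)
  exact hs.posDef_iff_isUnit.2 hu

lemma exists_next_ge_valueFn (hP : IsAdmissible γ P) (hR : R.PosDef)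
    (hRic : riccatiOp A B Q R γ P = P) (x : Fin n → ℝ) (u : Fin m → ℝ) (y : ℝ) :
    ∃ v, valueFn A Q γ P x y
      ≤ stage A B Q R γ x u v + (qf P v + 2 * |y + corr A B γ x u v|) := by
  obtain ⟨σ, h1, h2, h3⟩ := exists_eq_satValue (qf (openLoop A Q γ P - P) x) y
  obtain ⟨v, hv⟩ := exists_next_ge_abs (A := A) (B := B) (Q := Q) hP hR x u y h1 h2
  refine ⟨v, le_trans (le_of_eq ?_) hv⟩
  rw [valueFn, ← h3, hRic, qf_sub_matrix]
  ring

lemma le_valueFn (hP : IsAdmissible γ P) (hR : R.PosDef)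
    (hRic : riccatiOp A B Q R γ P = P) (x : Fin n → ℝ) (y : ℝ) :
    qf P x + 2 * |y| ≤ valueFn A Q γ P x y := by
  have hd := qf_openLoop_sub_nonneg hP hR hRic x
  rw [valueFn]
  rcases abs_cases y with ⟨hy, _⟩ | ⟨hy, _⟩
  · linarith [le_satValue (y := y) (σ := 1) hd (by norm_num) le_rfl]
  · linarith [le_satValue (y := y) (σ := -1) hd le_rfl (by norm_num)]

/-- The cost of the input `θ K x` against a mixture `σ` of the two signs. -/
lemma mixed_step_eq (hP : IsAdmissible γ P) (hR : R.PosDef)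
    (hRic : riccatiOp A B Q R γ P = P) (x v : Fin n → ℝ) (y θ σ : ℝ) {a p : Fin n → ℝ}
    (ha : gapMatrix γ P *ᵥ a = γ ^ 2 • (A *ᵥ x))
    (hp : gapMatrix γ P *ᵥ p
      = θ • (γ ^ 2 • (B *ᵥ (gain A B R γ P *ᵥ x))) - σ • (γ ^ 2 • (A *ᵥ x))) :
    stage A B Q R γ x (θ • (gain A B R γ P *ᵥ x)) v + qf P v
        + (1 - σ ^ 2) * qf (openLoop A Q γ P - P) v
        + 2 * σ * (y + corr A B γ x (θ • (gain A B R γ P *ᵥ x)) v)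
      = qf (openLoop A Q γ P) x + θ ^ 2 * qf (openLoop A Q γ P - P) x
        + 2 * σ * (y - θ * qf (openLoop A Q γ P - P) x)
        + (1 - σ ^ 2) * (qf (openLoop A Q γ P - P) v - qf (gapMatrix γ P) a)
        - qf (gapMatrix γ P) (v - p) := by
  set k := gain A B R γ P *ᵥ x with hk
  have h1 := stage_add_corr (A := A) (B := B) (Q := Q) (R := R) (γ := γ) x v (θ • k) σ
  have h2 := disturbance_square hP (B *ᵥ (θ • k) - σ • (A *ᵥ x)) v
  have hp' : γ ^ 2 • ((gapMatrix γ P)⁻¹ *ᵥ (B *ᵥ (θ • k) - σ • (A *ᵥ x))) = p := by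
    rw [← inv_mulVec_mulVec hP.2 p, hp, ← mulVec_smul, mulVec_smul B, smul_sub,
      smul_comm (γ ^ 2) θ, smul_comm (γ ^ 2) σ]
  have ha' : qf (gapMatrix γ P) a = (γ ^ 2) ^ 2 * qf (gapMatrix γ P)⁻¹ (A *ᵥ x) := by
    rw [← inv_mulVec_mulVec hP.2 a, ha, qf_inv_mulVec hP.2, qf_smul]
  have hM := hP.worst_isSymm
  have h3 : k ⬝ᵥ (Bᵀ *ᵥ (worstMatrix γ P *ᵥ (A *ᵥ x))) = qf (openLoop A Q γ P - P) x := by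
    rw [← hP.input_mulVec_gain hR, ← hk, qf_openLoop_sub hRic, ← hk, qf]
  rw [hp', qf_sub hM, mulVec_smul B, qf_smul, qf_smul, mulVec_smul, dotProduct_smul,
    smul_dotProduct, ← dotProduct_mul_mulVec, h3, smul_eq_mul, smul_eq_mul] at h2
  rw [qf_smul, mulVec_smul B] at h1
  have h4 := qf_worstMatrix (γ := γ) (P := P) (A *ᵥ x)
  have h5 := qf_openLoop (A := A) (Q := Q) (γ := γ) (P := P) x
  have h6 := qf_inputMatrix (B := B) (R := R) (γ := γ) (P := P) k
  rw [hk, ← qf_openLoop_sub hRic, ← hk] at h6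
  linear_combination h1 + h2 - h5 - θ ^ 2 * h6 + (1 - σ ^ 2) * ha' - (1 - σ ^ 2) * h4

lemma feedback_mulVec (B : Matrix (Fin n) (Fin m) ℝ) (K : Matrix (Fin m) (Fin n) ℝ)
    (hA : IsUnit A) (c : ℝ) (x : Fin n → ℝ) :
    (B * K * A⁻¹) *ᵥ (c • (A *ᵥ x)) = c • (B *ᵥ (K *ᵥ x)) := by
  rw [mulVec_smul, mulVec_mulVec, Matrix.mul_assoc,
    nonsing_inv_mul _ ((isUnit_iff_isUnit_det _).1 hA), Matrix.mul_one, mulVec_mulVec]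

/-- Represent the `satValue` at the next state by its maximizing `σ`. In `mixed_step_eq` the terms
in `θ` and `σ` are then bounded by the dual form `satValue_eq_sat`, and the remainder is nonpositive
by the pointwise bound. -/
lemma step_le_valueFn (hP : IsAdmissible γ P) (hR : R.PosDef)
    (hRic : riccatiOp A B Q R γ P = P) (hA : IsUnit A)
    (hb : ∀ θ σ : ℝ, -1 ≤ θ → θ ≤ 1 → -1 ≤ σ → σ ≤ 1 →
      PointwiseBound (gapMatrix γ P) (openLoop A Q γ P - P) (B * gain A B R γ P * A⁻¹) θ σ)
    (x v : Fin n → ℝ) (y : ℝ) {u : Fin m → ℝ}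
    (hu : u = sat (y / qf (openLoop A Q γ P - P) x) • (gain A B R γ P *ᵥ x)) :
    stage A B Q R γ x u v + valueFn A Q γ P v (y + corr A B γ x u v)
      ≤ valueFn A Q γ P x y := by
  subst hu
  set d := qf (openLoop A Q γ P - P) x with hd
  set θ := sat (y / d) with hθ
  obtain ⟨σ, h1, h2, h3⟩ := exists_eq_satValue (qf (openLoop A Q γ P - P) v)
    (y + corr A B γ x (θ • (gain A B R γ P *ᵥ x)) v)
  have hF := feedback_mulVec B (gain A B R γ P) hA (γ ^ 2) x
  have ha := mulVec_inv_mulVec hP.2 (γ ^ 2 • (A *ᵥ x))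
  have hp := mulVec_inv_mulVec hP.2
    (θ • (γ ^ 2 • (B *ᵥ (gain A B R γ P *ᵥ x))) - σ • (γ ^ 2 • (A *ᵥ x)))
  have h4 := mixed_step_eq hP hR hRic x v y θ σ ha hp
  have h5 := hb θ σ (neg_one_le_sat _) (sat_le_one _) h1 h2 _ v _ ha _ (by rw [hF]; exact hp)
  have h6 : σ * (y - θ * d) ≤ |y - θ * d| := by
    refine (le_abs_self _).trans ?_
    rw [abs_mul]
    exact mul_le_of_le_one_left (abs_nonneg _) (abs_le.2 ⟨h1, h2⟩)
  rw [valueFn, valueFn, ← h3, satValue_eq_sat y (qf_openLoop_sub_nonneg hP hR hRic x), ← hd, ← hθ]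
  have h7 : qf (openLoop A Q γ P) x = qf P x + d := by rw [hd, qf_sub_matrix]; ring
  rw [← hd] at h4
  linarith

/-- Cauchy–Schwarz for the pair `S`, `S⁻¹`, obtained by optimizing the multiple of the basis vector
in Fenchel's inequality. -/
lemma sq_apply_le {k : ℕ} {S : Matrix (Fin k) (Fin k) ℝ} (hS : S.PosDef) (e : Fin k → ℝ)
    (j : Fin k) : e j ^ 2 ≤ qf S⁻¹ (Pi.single j 1) * qf S e := by
  have hc : 0 < qf S⁻¹ (Pi.single j 1) := PosDef.qf_pos hS.inv (by simp)
  set c := qf S⁻¹ (Pi.single j 1) with hcdef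
  have h := two_mul_dotProduct_le hS e ((e j / c) • Pi.single j 1)
  rw [qf_smul, ← hcdef, dotProduct_smul, dotProduct_single, smul_eq_mul, mul_one] at h
  have h1 : 2 * (e j / c * e j) = 2 * (e j ^ 2 / c) := by ring
  have h2 : (e j / c) ^ 2 * c = e j ^ 2 / c := by field_simp
  rw [h1, h2] at h
  have h3 : e j ^ 2 / c ≤ qf S e := by linarith
  rwa [div_le_iff₀ hc, mul_comm] at h3

lemma tendsto_of_qf_sub_tendsto {k : ℕ} {S : Matrix (Fin k) (Fin k) ℝ} (hS : S.PosDef)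
    {u : ℕ → Fin k → ℝ} {u₀ : Fin k → ℝ}
    (h : Filter.Tendsto (fun j => qf S (u j - u₀)) Filter.atTop (nhds 0)) :
    Filter.Tendsto u Filter.atTop (nhds u₀) := by
  rw [tendsto_pi_nhds]
  intro j
  rw [tendsto_iff_norm_sub_tendsto_zero]
  have h1 : Filter.Tendsto (fun l => qf S⁻¹ (Pi.single j 1) * qf S (u l - u₀)) Filter.atTop
      (nhds 0) := by simpa using h.const_mul (qf S⁻¹ (Pi.single j 1))
  have h2 := squeeze_zero (fun l => sq_nonneg ((u l - u₀) j))
    (fun l => sq_apply_le hS (u l - u₀) j) h1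
  have h3 := h2.sqrt
  rw [Real.sqrt_zero] at h3
  refine h3.congr fun l => ?_
  rw [Real.sqrt_sq_eq_abs, Real.norm_eq_abs, Pi.sub_apply]

/-- If the one-step problem started at `y = |x|²_{T-P}` has value `valueFn`, then the infimum is
attained at `u = K x`, which gives the pointwise bound. -/
lemma pointwiseBound_of_step (hP : IsAdmissible γ P) (hR : R.PosDef) (hγ : 0 < γ)
    (hRic : riccatiOp A B Q R γ P = P) (hA : IsUnit A)
    (h : ∀ x, ∀ δ > 0, ∃ u, ∀ v, stage A B Q R γ x u v
        + valueFn A Q γ P v (qf (openLoop A Q γ P - P) x + corr A B γ x u v)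
      ≤ valueFn A Q γ P x (qf (openLoop A Q γ P - P) x) + δ)
    {σ : ℝ} (h1 : -1 ≤ σ) (h2 : σ ≤ 1) :
    PointwiseBound (gapMatrix γ P) (openLoop A Q γ P - P) (B * gain A B R γ P * A⁻¹) 1 σ := by
  have hAu := (isUnit_iff_isUnit_det _).1 hA
  intro a v z ha p hp
  -- Invertibility of `A` makes every `z` of the form `γ² A x`.
  set x := A⁻¹ *ᵥ ((γ ^ 2)⁻¹ • z) with hx
  have hAx : γ ^ 2 • (A *ᵥ x) = z := by
    rw [hx, mulVec_mulVec, mul_nonsing_inv _ hAu, one_mulVec, smul_smul,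
      mul_inv_cancel₀ (by positivity), one_smul]
  have hF : (B * gain A B R γ P * A⁻¹) *ᵥ z = γ ^ 2 • (B *ᵥ (gain A B R γ P *ᵥ x)) := by
    rw [← feedback_mulVec B (gain A B R γ P) hA, hAx]
  set d := qf (openLoop A Q γ P - P) x with hd
  have hd0 : 0 ≤ d := qf_openLoop_sub_nonneg hP hR hRic x
  have hval : valueFn A Q γ P x d = qf P x + 2 * d := by
    rw [valueFn, ← hd, satValue, abs_of_nonneg hd0, if_pos le_rfl]
  choose u hu using fun j : ℕ => h x (1 / ((j : ℝ) + 1)) Nat.one_div_pos_of_nat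
  rw [← hd, hval] at hu
  have hlim : Filter.Tendsto (fun j : ℕ => 1 / ((j : ℝ) + 1)) Filter.atTop (nhds 0) :=
    tendsto_one_div_add_atTop_nhds_zero_nat
  -- The worst disturbance for `i = 1` charges `|u - K x|²_S` on top of the value, so this excess is
  -- at most the slack and near-optimal inputs converge to `K x`.
  have hut : Filter.Tendsto u Filter.atTop (nhds (gain A B R γ P *ᵥ x)) := by
    refine tendsto_of_qf_sub_tendsto (hP.input_posDef (B := B) hR)
      (squeeze_zero (fun j => PosSemidef.qf_nonneg (hP.input_posDef hR).posSemidef _)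
        (fun j => ?_) hlim)
    obtain ⟨v', hv'⟩ := exists_worst_next (A := A) (B := B) (Q := Q) hP hR x (u j) (Or.inl rfl)
    have h3 := hu j v'
    have h4 := le_valueFn hP hR hRic v' (d + corr A B γ x (u j) v')
    rw [hRic, one_smul] at hv'
    linarith [le_abs_self (d + corr A B γ x (u j) v')]
  have hcont : Continuous fun u => stage A B Q R γ x u v + qf P v
      + (1 - σ ^ 2) * qf (openLoop A Q γ P - P) v + 2 * σ * (d + corr A B γ x u v) := by
    have := continuous_qf R
    unfold stage corr
    fun_prop
  -- For fixed `v` and `σ` the lower bound from `le_satValue` is continuous in `u`, so the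
  -- inequality passes to `u = K x`.
  have h5 := le_of_tendsto_of_tendsto ((hcont.tendsto _).comp hut) (hlim.const_add (qf P x + 2 * d))
    (Filter.Eventually.of_forall fun j => by
      have h3 := hu j v
      have h4 := le_satValue (y := d + corr A B γ x (u j) v) (σ := σ)
        (qf_openLoop_sub_nonneg hP hR hRic v) h1 h2
      rw [valueFn] at h3
      simp only [Function.comp]
      linarith)
  have h6 := mixed_step_eq hP hR hRic x v d 1 σ (ha.trans hAx.symm) (by rw [hp, hF, hAx])
  rw [one_smul, ← hd] at h6
  have h7 : qf (openLoop A Q γ P) x = qf P x + d := by rw [hd, qf_sub_matrix]; ring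
  simp only [add_zero] at h5
  linarith

end Step

/-! ### The data matrix -/

section Data

variable {A : Matrix (Fin n) (Fin n) ℝ} {B : Matrix (Fin n) (Fin m) ℝ}
  {Q : Matrix (Fin n) (Fin n) ℝ} {R : Matrix (Fin m) (Fin m) ℝ} {γ : ℝ}
  {P : Matrix (Fin n) (Fin n) ℝ}

/-- `γ² ‖diag{I, A}ᵀ‖²_Z`. -/
def diagCost (A : Matrix (Fin n) (Fin n) ℝ) (γ : ℝ) (Z : ZMat n) : ℝ :=
  γ ^ 2 * matSq (fromBlocks (1 : Matrix (Fin n) (Fin n) ℝ) 0 0 A)ᵀ Z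

lemma matSq_fromCols_one (C : Matrix (Fin n) (Fin n) ℝ) (Z : ZMat n) :
    matSq (fromCols (1 : Matrix (Fin n) (Fin n) ℝ) C)ᵀ Z
      = Z.toBlocks₁₁.trace + (C * Z.toBlocks₂₁).trace + (Z.toBlocks₁₂ * Cᵀ).trace
        + (C * Z.toBlocks₂₂ * Cᵀ).trace := by
  conv_lhs => rw [← fromBlocks_toBlocks Z]
  rw [matSq, transpose_transpose, fromCols_mul_fromBlocks, transpose_fromCols,
    fromCols_mul_fromRows]
  simp [Matrix.add_mul, trace_add]
  ring

lemma matSq_fromBlocks_one (Z : ZMat n) :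
    matSq (fromBlocks (1 : Matrix (Fin n) (Fin n) ℝ) 0 0 A)ᵀ Z
      = Z.toBlocks₁₁.trace + (A * Z.toBlocks₂₂ * Aᵀ).trace := by
  conv_lhs => rw [← fromBlocks_toBlocks Z]
  rw [matSq, transpose_transpose, fromBlocks_transpose, fromBlocks_multiply, fromBlocks_multiply]
  simp [trace, Fintype.sum_sum_type]

lemma toBlocks₂₁_eq {Z : ZMat n} (hZ : Z.PosSemidef) : Z.toBlocks₂₁ = Z.toBlocks₁₂ᵀ := by
  have h := hZ.isHermitian
  ext i j
  exact (h.apply (Sum.inr i) (Sum.inl j)).symm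

/-- Since `i² = 1`, the sign survives only in the off-diagonal blocks, which contribute equally by
symmetry of `Z`. -/
lemma matSq_fromCols_smul {Z : ZMat n} (hZ : Z.PosSemidef) {i : ℝ} (hi : i = 1 ∨ i = -1) :
    γ ^ 2 * matSq (fromCols (1 : Matrix (Fin n) (Fin n) ℝ) (i • A))ᵀ Z
      = diagCost A γ Z + 2 * i * innerAY A γ Z := by
  have h1 : (A * Z.toBlocks₁₂ᵀ).trace = (Aᵀ * Z.toBlocks₁₂).trace := by
    rw [← trace_transpose, transpose_mul, transpose_transpose, trace_mul_comm]
  have h2 : (Z.toBlocks₁₂ * Aᵀ).trace = (Aᵀ * Z.toBlocks₁₂).trace := trace_mul_comm _ _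
  have hi2 : i * i = 1 := by rcases hi with rfl | rfl <;> norm_num
  rw [matSq_fromCols_one, diagCost, matSq_fromBlocks_one, innerAY, toBlocks₂₁_eq hZ]
  simp only [transpose_smul, Matrix.smul_mul, Matrix.mul_smul, trace_smul, smul_smul, hi2,
    smul_eq_mul, h1, h2, one_mul]
  ring

lemma sq_mul_minSign {Z : ZMat n} (hZ : Z.PosSemidef) :
    γ ^ 2 * minSign A Z = diagCost A γ Z - 2 * |innerAY A γ Z| := by
  have h1 := matSq_fromCols_smul (A := A) (γ := γ) hZ (Or.inl rfl)
  have h2 := matSq_fromCols_smul (A := A) (γ := γ) hZ (Or.inr rfl)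
  rw [one_smul] at h1
  rw [neg_one_smul] at h2
  rw [minSign, mul_min_of_nonneg _ _ (sq_nonneg γ), h1, h2]
  rcases abs_cases (innerAY A γ Z) with ⟨h, _⟩ | ⟨h, _⟩ <;> rw [h]
  · rw [min_eq_right] <;> linarith
  · rw [min_eq_left] <;> linarith

lemma posSemidef_vecMulVec (w : Fin n ⊕ Fin n → ℝ) : (vecMulVec w w).PosSemidef := by
  simpa using posSemidef_vecMulVec_self_star w

lemma posSemidef_updateZ {Z : ZMat n} (hZ : Z.PosSemidef) (x v : Fin n → ℝ) (u : Fin m → ℝ) :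
    (updateZ B x Z u v).PosSemidef :=
  hZ.add (posSemidef_vecMulVec _)

lemma innerAY_add (Z Z' : ZMat n) : innerAY A γ (Z + Z') = innerAY A γ Z + innerAY A γ Z' := by
  rw [innerAY, innerAY, innerAY, ← trace_add, ← Matrix.mul_add, ← smul_add]; rfl

lemma diagCost_add (Z Z' : ZMat n) :
    diagCost A γ (Z + Z') = diagCost A γ Z + diagCost A γ Z' := by
  simp only [diagCost, matSq, Matrix.add_mul, trace_add, mul_add]

lemma innerAY_zero : innerAY A γ 0 = 0 := by
  have := innerAY_add (A := A) (γ := γ) 0 0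
  rw [add_zero] at this; linarith

lemma innerAY_vecMulVec (a x : Fin n → ℝ) :
    innerAY A γ (vecMulVec (Sum.elim a x) (Sum.elim a x)) = γ ^ 2 * (a ⬝ᵥ (A *ᵥ x)) := by
  have h : (vecMulVec (Sum.elim a x) (Sum.elim a x)).toBlocks₁₂ = vecMulVec a x := rfl
  rw [innerAY, h, Matrix.mul_smul, trace_smul, mul_vecMulVec, trace_vecMulVec, smul_eq_mul,
    dotProduct_comm, dotProduct_mul_mulVec, dotProduct_comm]

lemma diagCost_vecMulVec (a x : Fin n → ℝ) :
    diagCost A γ (vecMulVec (Sum.elim a x) (Sum.elim a x))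
      = γ ^ 2 * (a ⬝ᵥ a) + γ ^ 2 * ((A *ᵥ x) ⬝ᵥ (A *ᵥ x)) := by
  have h1 : (vecMulVec (Sum.elim a x) (Sum.elim a x)).toBlocks₁₁ = vecMulVec a a := rfl
  have h2 : (vecMulVec (Sum.elim a x) (Sum.elim a x)).toBlocks₂₂ = vecMulVec x x := rfl
  rw [diagCost, matSq_fromBlocks_one, h1, h2, trace_vecMulVec, mul_vecMulVec, vecMulVec_mul,
    trace_vecMulVec, vecMul_transpose]
  ring

lemma innerAY_updateZ (Z : ZMat n) (x v : Fin n → ℝ) (u : Fin m → ℝ) :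
    innerAY A γ (updateZ B x Z u v) = innerAY A γ Z + corr A B γ x u v := by
  rw [updateZ, innerAY_add, innerAY_vecMulVec, corr]

lemma stage_sub_diagCost (Z : ZMat n) (x v : Fin n → ℝ) (u : Fin m → ℝ) :
    qf Q x + qf R u - diagCost A γ (updateZ B x Z u v)
      = stage A B Q R γ x u v - diagCost A γ Z := by
  rw [updateZ, diagCost_add, diagCost_vecMulVec, stage]; ring

/-- Every value of `y` is reachable, by rank-one data whose upper half is a multiple of `A x ≠ 0`.
This lets the threshold `y = |x|²_D` be probed. -/
lemma exists_posSemidef_innerAY (hA : IsUnit A) (hγ : 0 < γ) {x : Fin n → ℝ} (hx : x ≠ 0)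
    (y : ℝ) : ∃ Z : ZMat n, Z.PosSemidef ∧ innerAY A γ Z = y := by
  have hAx : A *ᵥ x ≠ 0 := fun h => hx (by
    have := (mulVec_injective_iff_isUnit.2 hA) (h.trans (mulVec_zero A).symm)
    exact this)
  have h0 : (A *ᵥ x) ⬝ᵥ (A *ᵥ x) ≠ 0 := fun h => hAx (dotProduct_self_eq_zero.1 h)
  refine ⟨_, posSemidef_vecMulVec
    (Sum.elim ((y / (γ ^ 2 * ((A *ᵥ x) ⬝ᵥ (A *ᵥ x)))) • (A *ᵥ x)) x), ?_⟩
  rw [innerAY_vecMulVec, smul_dotProduct, smul_eq_mul]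
  field_simp

/-! ### The Bellman operator on functions of the state and of `⟨A, Y⟩` -/

/-- Reduces the Bellman operator to the pair `(x, y)`: the increment of `diagCost` is absorbed in
`stage`, that of `y` is `corr`. -/
lemma le_bellman {V : (Fin n → ℝ) → ZMat n → EReal} {L : (Fin n → ℝ) → ℝ → ℝ}
    (hV : ∀ v Z, Z.PosSemidef →
      ((L v (innerAY A γ Z) - diagCost A γ Z : ℝ) : EReal) ≤ V v Z)
    {x : Fin n → ℝ} {Z : ZMat n} (hZ : Z.PosSemidef) {r : ℝ}
    (h : ∀ u, ∃ v, r ≤ stage A B Q R γ x u v + L v (innerAY A γ Z + corr A B γ x u v)) :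
    ((r - diagCost A γ Z : ℝ) : EReal) ≤ bellman B Q R V x Z := by
  refine le_iInf fun u => ?_
  obtain ⟨v, hv⟩ := h u
  refine le_iSup_of_le v (le_trans ?_
    (add_le_add_right (hV v _ (posSemidef_updateZ (B := B) hZ x v u)) _))
  rw [← EReal.coe_add, EReal.coe_le_coe_iff, innerAY_updateZ]
  linarith [stage_sub_diagCost (A := A) (B := B) (Q := Q) (R := R) (γ := γ) Z x v u]

lemma bellman_le {V : (Fin n → ℝ) → ZMat n → EReal} {L : (Fin n → ℝ) → ℝ → ℝ}
    (hV : ∀ v Z, Z.PosSemidef →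
      V v Z ≤ ((L v (innerAY A γ Z) - diagCost A γ Z : ℝ) : EReal))
    {x : Fin n → ℝ} {Z : ZMat n} (hZ : Z.PosSemidef) {r : ℝ} (u : Fin m → ℝ)
    (h : ∀ v, stage A B Q R γ x u v + L v (innerAY A γ Z + corr A B γ x u v) ≤ r) :
    bellman B Q R V x Z ≤ ((r - diagCost A γ Z : ℝ) : EReal) := by
  refine iInf_le_of_le u (iSup_le fun v => ?_)
  refine (add_le_add_right (hV v _ (posSemidef_updateZ (B := B) hZ x v u)) _).trans ?_
  rw [← EReal.coe_add, EReal.coe_le_coe_iff, innerAY_updateZ]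
  linarith [stage_sub_diagCost (A := A) (B := B) (Q := Q) (R := R) (γ := γ) Z x v u, h v]

/-- The slack `δ` is there because the infimum over inputs is not known to be attained. -/
lemma exists_input_of_bellman_le {V : (Fin n → ℝ) → ZMat n → EReal} {L : (Fin n → ℝ) → ℝ → ℝ}
    (hV : ∀ v Z, Z.PosSemidef →
      ((L v (innerAY A γ Z) - diagCost A γ Z : ℝ) : EReal) ≤ V v Z)
    {x : Fin n → ℝ} {Z : ZMat n} (hZ : Z.PosSemidef) {r : ℝ}
    (h : bellman B Q R V x Z ≤ ((r - diagCost A γ Z : ℝ) : EReal)) {δ : ℝ} (hδ : 0 < δ) :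
    ∃ u, ∀ v, stage A B Q R γ x u v + L v (innerAY A γ Z + corr A B γ x u v) ≤ r + δ := by
  have h1 : bellman B Q R V x Z < ((r + δ - diagCost A γ Z : ℝ) : EReal) :=
    h.trans_lt (EReal.coe_lt_coe_iff.2 (by linarith))
  obtain ⟨u, hu⟩ := iInf_lt_iff.1 h1
  refine ⟨u, fun v => ?_⟩
  have h2 := (add_le_add_right (hV v _ (posSemidef_updateZ (B := B) hZ x v u)) _).trans
    ((le_iSup (fun v => ((qf Q x + qf R u : ℝ) : EReal) + V v (updateZ B x Z u v)) v).trans hu.le)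
  rw [← EReal.coe_add, EReal.coe_le_coe_iff, innerAY_updateZ] at h2
  linarith [stage_sub_diagCost (A := A) (B := B) (Q := Q) (R := R) (γ := γ) Z x v u]

lemma V_zero_eq (x : Fin n → ℝ) {Z : ZMat n} (hZ : Z.PosSemidef) :
    V A B Q R γ 0 x Z = ((2 * |innerAY A γ Z| - diagCost A γ Z : ℝ) : EReal) := by
  rw [V, EReal.coe_eq_coe_iff, sq_mul_minSign hZ]; ring

lemma Vbar_zero_eq (x : Fin n → ℝ) {Z : ZMat n} (hZ : Z.PosSemidef) :
    Vbar A B Q R γ P 0 x Z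
      = ((qf P x + 2 * |innerAY A γ Z| - diagCost A γ Z : ℝ) : EReal) := by
  rw [Vbar, EReal.coe_eq_coe_iff, sq_mul_minSign hZ]; ring

lemma Vstar_eq (hT : Tmat A Q γ P = openLoop A Q γ P) (x : Fin n → ℝ) {Z : ZMat n}
    (hZ : Z.PosSemidef) :
    Vstar A Q γ P x Z = valueFn A Q γ P x (innerAY A γ Z) - diagCost A γ Z := by
  rw [Vstar, valueFn, satValue, hT]
  split_ifs with h
  · rw [sq_mul_minSign hZ]; ring
  · rw [qf_sub_matrix, diagCost]; ring

lemma le_Vbar (hP : IsAdmissible γ P) (hR : R.PosDef) (hRic : riccatiOp A B Q R γ P = P) (k : ℕ)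
    (x : Fin n → ℝ) (Z : ZMat n) (hZ : Z.PosSemidef) :
    ((qf P x + 2 * |innerAY A γ Z| - diagCost A γ Z : ℝ) : EReal) ≤ Vbar A B Q R γ P k x Z := by
  induction k generalizing x Z with
  | zero => rw [Vbar_zero_eq x hZ]
  | succ k ih =>
    refine le_bellman (L := fun x y => qf P x + 2 * |y|) ih hZ fun u => ?_
    have := exists_next_ge_riccati (A := A) (B := B) (Q := Q) hP hR x u (innerAY A γ Z)
    rwa [hRic] at this

lemma valueFn_le_Vbar (hP : IsAdmissible γ P) (hR : R.PosDef)
    (hRic : riccatiOp A B Q R γ P = P) (k : ℕ) (x : Fin n → ℝ) (Z : ZMat n)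
    (hZ : Z.PosSemidef) :
    ((valueFn A Q γ P x (innerAY A γ Z) - diagCost A γ Z : ℝ) : EReal)
      ≤ Vbar A B Q R γ P (k + 1) x Z :=
  le_bellman (L := fun x y => qf P x + 2 * |y|) (le_Vbar hP hR hRic k) hZ fun u =>
    exists_next_ge_valueFn hP hR hRic x u _

/-- With the pointwise bound, `valueFn` is a supersolution of the Bellman equation. -/
lemma bellman_le_valueFn (hP : IsAdmissible γ P) (hR : R.PosDef)
    (hRic : riccatiOp A B Q R γ P = P) (hA : IsUnit A)
    (hb : ∀ θ σ : ℝ, -1 ≤ θ → θ ≤ 1 → -1 ≤ σ → σ ≤ 1 →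
      PointwiseBound (gapMatrix γ P) (openLoop A Q γ P - P) (B * gain A B R γ P * A⁻¹) θ σ)
    {V : (Fin n → ℝ) → ZMat n → EReal}
    (hV : ∀ v Z, Z.PosSemidef →
      V v Z ≤ ((valueFn A Q γ P v (innerAY A γ Z) - diagCost A γ Z : ℝ) : EReal))
    (x : Fin n → ℝ) (Z : ZMat n) (hZ : Z.PosSemidef) :
    bellman B Q R V x Z
      ≤ ((valueFn A Q γ P x (innerAY A γ Z) - diagCost A γ Z : ℝ) : EReal) :=
  bellman_le hV hZ _ fun v => step_le_valueFn hP hR hRic hA hb x v _ rfl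

/-- No matrix inequality is needed here: `2 |·|` is represented by `σ = ±1`, where the factor `1 -
σ²` of the problematic term vanishes. -/
lemma step_valueFn_zero_le (hP : IsAdmissible γ P) (hR : R.PosDef)
    (hRic : riccatiOp A B Q R γ P = P) (x v : Fin n → ℝ) (y : ℝ) :
    stage A B Q R γ x (sat (y / qf (openLoop A Q γ P - P) x) • (gain A B R γ P *ᵥ x)) v
      + (qf P v + 2 * |y + corr A B γ x
          (sat (y / qf (openLoop A Q γ P - P) x) • (gain A B R γ P *ᵥ x)) v|)
      ≤ valueFn A Q γ P x y := by
  set d := qf (openLoop A Q γ P - P) x with hd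
  set θ := sat (y / d) with hθ
  obtain ⟨i, hi, habs⟩ : ∃ i : ℝ, (i = 1 ∨ i = -1) ∧
      i * (y + corr A B γ x (θ • (gain A B R γ P *ᵥ x)) v)
        = |y + corr A B γ x (θ • (gain A B R γ P *ᵥ x)) v| := by
    rcases abs_cases (y + corr A B γ x (θ • (gain A B R γ P *ᵥ x)) v) with ⟨h, _⟩ | ⟨h, _⟩
    · exact ⟨1, Or.inl rfl, by rw [h]; ring⟩
    · exact ⟨-1, Or.inr rfl, by rw [h]; ring⟩
  have h4 := mixed_step_eq hP hR hRic x v y θ i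
    (mulVec_inv_mulVec hP.2 (γ ^ 2 • (A *ᵥ x))) (mulVec_inv_mulVec hP.2 _)
  have hi2 : 1 - i ^ 2 = 0 := by rcases hi with rfl | rfl <;> norm_num
  rw [hi2, zero_mul, zero_mul, ← hd] at h4
  have h5 := PosSemidef.qf_nonneg hP.2.posSemidef (v - (gapMatrix γ P)⁻¹ *ᵥ
    (θ • (γ ^ 2 • (B *ᵥ (gain A B R γ P *ᵥ x))) - i • (γ ^ 2 • (A *ᵥ x))))
  have h6 : i * (y - θ * d) ≤ |y - θ * d| := by
    rcases hi with rfl | rfl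
    · linarith [le_abs_self (y - θ * d)]
    · linarith [neg_le_abs (y - θ * d)]
  rw [valueFn, satValue_eq_sat y (qf_openLoop_sub_nonneg hP hR hRic x), ← hd, ← hθ]
  have h7 : qf (openLoop A Q γ P) x = qf P x + d := by rw [hd, qf_sub_matrix]; ring
  linarith

lemma Vbar_one_eq (hP : IsAdmissible γ P) (hR : R.PosDef) (hRic : riccatiOp A B Q R γ P = P)
    (x : Fin n → ℝ) (Z : ZMat n) (hZ : Z.PosSemidef) :
    Vbar A B Q R γ P 1 x Z
      = ((valueFn A Q γ P x (innerAY A γ Z) - diagCost A γ Z : ℝ) : EReal) :=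
  le_antisymm
    (bellman_le (L := fun x y => qf P x + 2 * |y|) (fun v _ hZ => (Vbar_zero_eq v hZ).le) hZ _
      fun v => step_valueFn_zero_le hP hR hRic x v _)
    (valueFn_le_Vbar hP hR hRic 0 x Z hZ)

lemma Vbar_eq (hP : IsAdmissible γ P) (hR : R.PosDef)
    (hRic : riccatiOp A B Q R γ P = P) (hA : IsUnit A)
    (hb : ∀ θ σ : ℝ, -1 ≤ θ → θ ≤ 1 → -1 ≤ σ → σ ≤ 1 →
      PointwiseBound (gapMatrix γ P) (openLoop A Q γ P - P) (B * gain A B R γ P * A⁻¹) θ σ)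
    (k : ℕ) (x : Fin n → ℝ) (Z : ZMat n) (hZ : Z.PosSemidef) :
    Vbar A B Q R γ P (k + 1) x Z
      = ((valueFn A Q γ P x (innerAY A γ Z) - diagCost A γ Z : ℝ) : EReal) := by
  induction k generalizing x Z with
  | zero => exact Vbar_one_eq hP hR hRic x Z hZ
  | succ k ih =>
    exact le_antisymm (bellman_le_valueFn hP hR hRic hA hb (fun v Z hZ => (ih v Z hZ).le) x Z hZ)
      (valueFn_le_Vbar hP hR hRic (k + 1) x Z hZ)

lemma V_le (hP : IsAdmissible γ P) (hR : R.PosDef)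
    (hRic : riccatiOp A B Q R γ P = P) (hA : IsUnit A)
    (hb : ∀ θ σ : ℝ, -1 ≤ θ → θ ≤ 1 → -1 ≤ σ → σ ≤ 1 →
      PointwiseBound (gapMatrix γ P) (openLoop A Q γ P - P) (B * gain A B R γ P * A⁻¹) θ σ)
    (k : ℕ) (x : Fin n → ℝ) (Z : ZMat n) (hZ : Z.PosSemidef) :
    V A B Q R γ k x Z
      ≤ ((valueFn A Q γ P x (innerAY A γ Z) - diagCost A γ Z : ℝ) : EReal) := by
  induction k generalizing x Z with
  | zero =>
    rw [V_zero_eq x hZ, EReal.coe_le_coe_iff]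
    linarith [le_valueFn hP hR hRic x (innerAY A γ Z), PosSemidef.qf_nonneg hP.1 x]
  | succ k ih => exact bellman_le_valueFn hP hR hRic hA hb ih x Z hZ

/-- Invariance of the iterates `V̄_k` yields the pointwise bound. -/
lemma pointwiseBound_of_Vbar (hP : IsAdmissible γ P) (hR : R.PosDef) (hγ : 0 < γ)
    (hRic : riccatiOp A B Q R γ P = P) (hA : IsUnit A)
    (h : ∀ (x : Fin n → ℝ) (Z : ZMat n), Z.PosSemidef →
      Vbar A B Q R γ P 2 x Z = Vbar A B Q R γ P 1 x Z)
    {σ : ℝ} (h1 : -1 ≤ σ) (h2 : σ ≤ 1) :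
    PointwiseBound (gapMatrix γ P) (openLoop A Q γ P - P) (B * gain A B R γ P * A⁻¹) 1 σ := by
  refine pointwiseBound_of_step hP hR hγ hRic hA (fun x δ hδ => ?_) h1 h2
  obtain ⟨Z, hZ, hy⟩ : ∃ Z : ZMat n, Z.PosSemidef ∧
      innerAY A γ Z = qf (openLoop A Q γ P - P) x := by
    by_cases hx : x = 0
    · exact ⟨0, PosSemidef.zero, by rw [hx, qf_zero, innerAY_zero]⟩
    · exact exists_posSemidef_innerAY hA hγ hx _
  have h3 := (h x Z hZ).trans (Vbar_one_eq hP hR hRic x Z hZ)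
  have := exists_input_of_bellman_le (L := valueFn A Q γ P)
    (fun v Z hZ => (Vbar_one_eq hP hR hRic v Z hZ).ge) hZ h3.le hδ
  rwa [hy] at this

end Data

/-! ### Riccati iterations -/

/-- The Riccati iteration started at zero. -/
def riccatiSeq (A : Matrix (Fin n) (Fin n) ℝ) (B : Matrix (Fin n) (Fin m) ℝ)
    (Q : Matrix (Fin n) (Fin n) ℝ) (R : Matrix (Fin m) (Fin m) ℝ) (γ : ℝ) :
    ℕ → Matrix (Fin n) (Fin n) ℝ
  | 0 => 0
  | k + 1 => riccatiOp A B Q R γ (riccatiSeq A B Q R γ k)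

lemma continuousAt_matrix_mul {X : Type*} [TopologicalSpace X] {k l r : ℕ}
    {f : X → Matrix (Fin k) (Fin l) ℝ} {g : X → Matrix (Fin l) (Fin r) ℝ} {a : X}
    (hf : ContinuousAt f a) (hg : ContinuousAt g a) : ContinuousAt (fun y => f y * g y) a :=
  (Continuous.matrix_mul continuous_fst continuous_snd).continuousAt.comp
    (f := fun y => (f y, g y)) (hf.prodMk hg)

lemma continuousAt_inv_of_posDef {k : ℕ} {M : Matrix (Fin k) (Fin k) ℝ} (hM : M.PosDef) :
    ContinuousAt (fun N : Matrix (Fin k) (Fin k) ℝ => N⁻¹) M := by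
  refine continuousAt_matrix_inv M ?_
  rw [Ring.inverse_eq_inv']
  exact continuousAt_inv₀ hM.det_pos.ne'

section Iteration

variable {A : Matrix (Fin n) (Fin n) ℝ} {B : Matrix (Fin n) (Fin m) ℝ}
  {Q : Matrix (Fin n) (Fin n) ℝ} {R : Matrix (Fin m) (Fin m) ℝ} {γ : ℝ}
  {P P' : Matrix (Fin n) (Fin n) ℝ}

lemma IsAdmissible.continuousAt_worstMatrix (hP : IsAdmissible γ P) :
    ContinuousAt (worstMatrix γ) P := by
  have h1 : ContinuousAt (gapMatrix γ) P := by unfold gapMatrix; fun_prop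
  have h2 : ContinuousAt (fun P => (gapMatrix γ P)⁻¹) P :=
    (continuousAt_inv_of_posDef hP.2).comp h1
  unfold worstMatrix
  fun_prop

lemma IsAdmissible.continuousAt_openLoop (hP : IsAdmissible γ P) :
    ContinuousAt (openLoop A Q γ) P :=
  continuousAt_const.add (continuousAt_matrix_mul
    (continuousAt_matrix_mul continuousAt_const hP.continuousAt_worstMatrix) continuousAt_const)

lemma IsAdmissible.continuousAt_riccatiOp (hP : IsAdmissible γ P) (hR : R.PosDef) :
    ContinuousAt (riccatiOp A B Q R γ) P := by
  have hM := hP.continuousAt_worstMatrix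
  have hS : ContinuousAt (inputMatrix B R γ) P :=
    continuousAt_const.add (continuousAt_matrix_mul
      (continuousAt_matrix_mul continuousAt_const hM) continuousAt_const)
  have hS' : ContinuousAt (fun P => (inputMatrix B R γ P)⁻¹) P :=
    (continuousAt_inv_of_posDef (hP.input_posDef hR)).comp hS
  have hK : ContinuousAt (gain A B R γ) P :=
    continuousAt_matrix_mul hS' (continuousAt_matrix_mul
      (continuousAt_matrix_mul continuousAt_const hM) continuousAt_const)
  have hK' : ContinuousAt (fun P => (gain A B R γ P)ᵀ) P :=
    (continuous_id.matrix_transpose.continuousAt).comp hK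
  exact hP.continuousAt_openLoop.sub
    (continuousAt_matrix_mul (continuousAt_matrix_mul hK' hS) hK)

lemma IsAdmissible.of_le (hP : IsAdmissible γ P) (h' : P'.PosSemidef)
    (h : ∀ x, qf P' x ≤ qf P x) : IsAdmissible γ P' := by
  refine ⟨h', posDef_of_qf ?_ fun x hx => ?_⟩
  · have := (PosSemidef.isSymm h').eq
    simp [IsSymm, gapMatrix, this]
  · have := PosDef.qf_pos hP.2 hx
    rw [qf_gapMatrix] at this ⊢
    linarith [h x]

lemma IsAdmissible.le_qf_riccatiOp (hP : IsAdmissible γ P) (hR : R.PosDef) (x : Fin n → ℝ) :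
    qf Q x ≤ qf (riccatiOp A B Q R γ P) x := by
  have h := input_square (A := A) (B := B) (Q := Q) hP hR x (-(gain A B R γ P *ᵥ x))
  rw [neg_add_cancel, qf_zero] at h
  linarith [PosSemidef.qf_nonneg hR.posSemidef (-(gain A B R γ P *ᵥ x)),
    hP.qf_worst_nonneg (A *ᵥ x + B *ᵥ (-(gain A B R γ P *ᵥ x)))]

/-- Use the minimizing input for `P'` as a competitor in the problem for `P`. -/
lemma qf_riccatiOp_mono (hP : IsAdmissible γ P) (hP' : IsAdmissible γ P') (hR : R.PosDef)
    (h : ∀ x, qf P x ≤ qf P' x) (x : Fin n → ℝ) :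
    qf (riccatiOp A B Q R γ P) x ≤ qf (riccatiOp A B Q R γ P') x := by
  have h1 := input_square (A := A) (B := B) (Q := Q) hP hR x (-(gain A B R γ P' *ᵥ x))
  have h2 := input_square (A := A) (B := B) (Q := Q) hP' hR x (-(gain A B R γ P' *ᵥ x))
  rw [neg_add_cancel, qf_zero] at h2
  linarith [qf_worst_mono hP hP' h (A *ᵥ x + B *ᵥ (-(gain A B R γ P' *ᵥ x))),
    PosSemidef.qf_nonneg (hP.input_posDef (B := B) hR).posSemidef
      (-(gain A B R γ P' *ᵥ x) + gain A B R γ P *ᵥ x)]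

lemma riccatiSeq_le (hP : IsAdmissible γ P) (hQ : Q.PosDef) (hR : R.PosDef)
    (hRic : riccatiOp A B Q R γ P = P) (k : ℕ) :
    IsAdmissible γ (riccatiSeq A B Q R γ k) ∧ ∀ x, qf (riccatiSeq A B Q R γ k) x ≤ qf P x := by
  induction k with
  | zero =>
    have h : ∀ x, qf (riccatiSeq A B Q R γ 0) x ≤ qf P x := fun x => by
      simpa [riccatiSeq, qf] using PosSemidef.qf_nonneg hP.1 x
    exact ⟨hP.of_le PosSemidef.zero h, h⟩
  | succ k ih =>
    have h : ∀ x, qf (riccatiSeq A B Q R γ (k + 1)) x ≤ qf P x := fun x => by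
      have := qf_riccatiOp_mono (A := A) (B := B) (Q := Q) ih.1 hP hR ih.2 x
      rwa [hRic] at this
    exact ⟨hP.of_le (posSemidef_of_qf (ih.1.riccatiOp_isSymm hQ hR) fun x =>
      (PosSemidef.qf_nonneg hQ.posSemidef x).trans (ih.1.le_qf_riccatiOp hR x)) h, h⟩

lemma riccatiSeq_mono (hP : IsAdmissible γ P) (hQ : Q.PosDef) (hR : R.PosDef)
    (hRic : riccatiOp A B Q R γ P = P) (x : Fin n → ℝ) :
    Monotone fun k => qf (riccatiSeq A B Q R γ k) x := by
  have hs := riccatiSeq_le hP hQ hR hRic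
  refine monotone_nat_of_le_succ fun k => ?_
  induction k generalizing x with
  | zero => simpa [riccatiSeq, qf] using PosSemidef.qf_nonneg (hs 1).1.1 x
  | succ k ih => exact qf_riccatiOp_mono (hs k).1 (hs (k + 1)).1 hR ih x

/-- Monotone bounded quadratic forms converge pointwise, and polarization recovers the entries. -/
lemma exists_tendsto_of_qf_monotone {k : ℕ} {S : ℕ → Matrix (Fin k) (Fin k) ℝ}
    (hS : ∀ j, (S j).IsSymm) (hm : ∀ x, Monotone fun j => qf (S j) x)
    (hb : ∀ x, BddAbove (Set.range fun j => qf (S j) x)) :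
    ∃ M, Filter.Tendsto S Filter.atTop (nhds M) := by
  have hq : ∀ x, ∃ l, Filter.Tendsto (fun j => qf (S j) x) Filter.atTop (nhds l) := fun x =>
    ⟨_, tendsto_atTop_ciSup (hm x) (hb x)⟩
  have hentry : ∀ a b, ∃ l, Filter.Tendsto (fun j => S j a b) Filter.atTop (nhds l) := by
    intro a b
    obtain ⟨l₁, h₁⟩ := hq (Pi.single a 1 + Pi.single b 1)
    obtain ⟨l₂, h₂⟩ := hq (Pi.single a 1)
    obtain ⟨l₃, h₃⟩ := hq (Pi.single b 1)
    refine ⟨(l₁ - l₂ - l₃) / 2, (((h₁.sub h₂).sub h₃).div_const 2).congr fun j => ?_⟩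
    rw [qf_add (hS j)]
    simp only [mulVec_single_one, single_one_dotProduct, col_apply]
    ring
  choose M hM using hentry
  exact ⟨M, tendsto_pi_nhds.2 fun a => tendsto_pi_nhds.2 fun b => hM a b⟩

lemma isRiccatiSolution_of_fixed (hP : IsAdmissible γ P) (hQ : Q.PosDef) (hR : R.PosDef)
    (hRic : riccatiOp A B Q R γ P = P) : IsRiccatiSolution A B Q R γ P := by
  refine ⟨posDef_of_qf (PosSemidef.isSymm hP.1) fun x hx => ?_, hP.2, fun x => ?_⟩
  · have := hP.le_qf_riccatiOp (A := A) (B := B) (Q := Q) hR x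
    rw [hRic] at this
    exact (PosDef.qf_pos hQ hx).trans_le this
  · rw [iInf_riccatiMax hP hR, hRic]

/-- The Riccati iteration started at zero converges to the least solution. -/
lemma riccatiSeq_tendsto (hQ : Q.PosDef) (hR : R.PosDef)
    (hP : IsLeastRiccatiSolution A B Q R γ P) :
    Filter.Tendsto (riccatiSeq A B Q R γ) Filter.atTop (nhds P) := by
  have hPa := hP.1.isAdmissible
  have hRic := hP.1.riccatiOp_eq hQ hR
  have hs := riccatiSeq_le hPa hQ hR hRic
  obtain ⟨L, hL⟩ := exists_tendsto_of_qf_monotone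
    (fun j => PosSemidef.isSymm (hs j).1.1) (riccatiSeq_mono hPa hQ hR hRic)
    (fun x => ⟨qf P x, by rintro _ ⟨j, rfl⟩; exact (hs j).2 x⟩)
  have hq : ∀ x, Filter.Tendsto (fun k => qf (riccatiSeq A B Q R γ k) x) Filter.atTop
      (nhds (qf L x)) := fun x => ((continuous_qf_matrix x).tendsto L).comp hL
  have hLsymm : L.IsSymm :=
    tendsto_nhds_unique (((continuous_id.matrix_transpose).tendsto L).comp hL)
      (hL.congr fun k => (PosSemidef.isSymm (hs k).1.1).eq.symm)
  have hLle : ∀ x, qf L x ≤ qf P x := fun x => le_of_tendsto' (hq x) fun k => (hs k).2 x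
  -- The limit lies between `0` and `P`, so the Riccati operator is continuous there and fixes it;
  -- minimality of `P` then forces equality.
  have hLa : IsAdmissible γ L := hPa.of_le (posSemidef_of_qf hLsymm fun x =>
    ge_of_tendsto' (hq x) fun k => PosSemidef.qf_nonneg (hs k).1.1 x) hLle
  have hfix : riccatiOp A B Q R γ L = L :=
    tendsto_nhds_unique ((hLa.continuousAt_riccatiOp hR).tendsto.comp hL)
      (hL.comp (Filter.tendsto_add_atTop_nat 1))
  have hge := hP.2 L (isRiccatiSolution_of_fixed hLa hQ hR hfix)
  have : L = P := eq_of_qf_eq hLsymm (PosSemidef.isSymm hPa.1) fun x => by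
    have := PosSemidef.qf_nonneg hge x
    rw [qf_sub_matrix] at this
    exact le_antisymm (hLle x) (by linarith)
  rwa [this] at hL

lemma le_V (hs : ∀ k, IsAdmissible γ (riccatiSeq A B Q R γ k)) (hR : R.PosDef) (k : ℕ)
    (x : Fin n → ℝ) (Z : ZMat n) (hZ : Z.PosSemidef) :
    ((qf (riccatiSeq A B Q R γ k) x + 2 * |innerAY A γ Z| - diagCost A γ Z : ℝ) : EReal)
      ≤ V A B Q R γ k x Z := by
  induction k generalizing x Z with
  | zero => rw [V_zero_eq x hZ]; simp [riccatiSeq, qf]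
  | succ k ih =>
    exact le_bellman (L := fun x y => qf (riccatiSeq A B Q R γ k) x + 2 * |y|) ih hZ fun u =>
      exists_next_ge_riccati (hs k) hR x u _

lemma V_tendsto (hQ : Q.PosDef) (hR : R.PosDef) (hA : IsUnit A)
    (hP : IsLeastRiccatiSolution A B Q R γ P)
    (hb : ∀ θ σ : ℝ, -1 ≤ θ → θ ≤ 1 → -1 ≤ σ → σ ≤ 1 →
      PointwiseBound (gapMatrix γ P) (openLoop A Q γ P - P) (B * gain A B R γ P * A⁻¹) θ σ)
    (x : Fin n → ℝ) (Z : ZMat n) (hZ : Z.PosSemidef) :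
    Filter.Tendsto (fun k => V A B Q R γ k x Z) Filter.atTop
      (nhds ((valueFn A Q γ P x (innerAY A γ Z) - diagCost A γ Z : ℝ) : EReal)) := by
  have hPa := hP.1.isAdmissible
  have hRic := hP.1.riccatiOp_eq hQ hR
  have hs := riccatiSeq_le hPa hQ hR hRic
  have hlim := riccatiSeq_tendsto hQ hR hP
  -- The mixture `σ` that is optimal for the limit `P` is used at every `k`; the resulting lower
  -- bounds on `V_{k+1}` converge to `valueFn`.
  obtain ⟨σ, h1, h2, h3⟩ := exists_eq_satValue (qf (openLoop A Q γ P - P) x) (innerAY A γ Z)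
  have hT := ((continuous_qf_matrix x).tendsto _).comp
    ((hPa.continuousAt_openLoop (A := A) (Q := Q)).tendsto.comp hlim)
  have hN := ((continuous_qf_matrix x).tendsto _).comp
    (hlim.comp (Filter.tendsto_add_atTop_nat 1))
  have hlow := ((hT.sub ((hT.sub hN).const_mul (σ ^ 2))).add_const
    (2 * σ * innerAY A γ Z)).sub_const (diagCost A γ Z)
  have hval : valueFn A Q γ P x (innerAY A γ Z) = qf (openLoop A Q γ P) x
      - σ ^ 2 * (qf (openLoop A Q γ P) x - qf P x) + 2 * σ * innerAY A γ Z := by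
    rw [valueFn, ← h3, qf_sub_matrix]; ring
  rw [← Filter.tendsto_add_atTop_iff_nat 1]
  refine tendsto_of_tendsto_of_tendsto_of_le_of_le
    (g := fun k => ((qf (openLoop A Q γ (riccatiSeq A B Q R γ k)) x
      - σ ^ 2 * (qf (openLoop A Q γ (riccatiSeq A B Q R γ k)) x
        - qf (riccatiSeq A B Q R γ (k + 1)) x)
      + 2 * σ * innerAY A γ Z - diagCost A γ Z : ℝ) : EReal))
    ?_ tendsto_const_nhds ?_ (fun k => V_le hPa hR hRic hA hb (k + 1) x Z hZ)
  · rw [hval]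
    exact (continuous_coe_real_ereal.tendsto _).comp hlow
  · intro k
    exact le_bellman (L := fun x y => qf (riccatiSeq A B Q R γ k) x + 2 * |y|)
      (le_V (fun k => (hs k).1) hR k) hZ fun u => exists_next_ge_abs (hs k).1 hR x u _ h1 h2

end Iteration

/-! ### The game -/

/-- The inputs that the control law `μ` generates along the state sequence `x`. -/
def inputSeq (μ : ControlLaw n m) (x : ℕ → Fin n → ℝ) (t : ℕ) : Fin m → ℝ :=
  μ t (fun τ => x τ) (fun τ => inputSeq μ x τ)
termination_by t
decreasing_by exact τ.2

/-- Causality: rewriting future states leaves present and past inputs unchanged. -/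
lemma inputSeq_congr (μ : ControlLaw n m) {x x' : ℕ → Fin n → ℝ} (t : ℕ)
    (h : ∀ τ ≤ t, x τ = x' τ) : inputSeq μ x t = inputSeq μ x' t := by
  induction t using Nat.strong_induction_on with
  | _ t ih =>
    rw [inputSeq, inputSeq]
    congr 1
    · funext τ
      exact h τ (Nat.lt_succ_iff.1 τ.2)
    · funext τ
      exact ih τ τ.2 fun s hs => h s (hs.trans τ.2.le)

section Game

variable {A : Matrix (Fin n) (Fin n) ℝ} {B : Matrix (Fin n) (Fin m) ℝ}
  {Q : Matrix (Fin n) (Fin n) ℝ} {R : Matrix (Fin m) (Fin m) ℝ} {γ : ℝ}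
  {P : Matrix (Fin n) (Fin n) ℝ}

/-- The stage cost along `x`, the sign of the plant being `-i`. -/
def signedStage (A : Matrix (Fin n) (Fin n) ℝ) (B : Matrix (Fin n) (Fin m) ℝ)
    (Q : Matrix (Fin n) (Fin n) ℝ) (R : Matrix (Fin m) (Fin m) ℝ) (γ : ℝ)
    (i : ℝ) (x : ℕ → Fin n → ℝ) (u : ℕ → Fin m → ℝ) (t : ℕ) : ℝ :=
  stage A B Q R γ (x t) (u t) (x (t + 1)) + 2 * i * corr A B γ (x t) (u t) (x (t + 1))

lemma signedStage_eq {i : ℝ} (hi : i = 1 ∨ i = -1) {w x : ℕ → Fin n → ℝ} {u : ℕ → Fin m → ℝ}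
    {t : ℕ} (h : x (t + 1) = (-i) • (A *ᵥ x t) + B *ᵥ u t + w t) :
    signedStage A B Q R γ i x u t
      = qf Q (x t) + qf R (u t) - γ ^ 2 * (w t ⬝ᵥ w t) := by
  have hi2 : 1 - i ^ 2 = 0 := by rcases hi with rfl | rfl <;> norm_num
  have hw : B *ᵥ u t - i • (A *ᵥ x t) - x (t + 1) = -w t := by
    rw [h, neg_smul]; abel
  rw [signedStage, stage_add_corr, hi2, hw, neg_dotProduct_neg]
  ring

/-- The adversary may choose the states directly, since the disturbance is additive and
unconstrained and can be read off from the plant equation. -/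
lemma sum_signedStage_le_worstCost (μ : ControlLaw n m) {i : ℝ} (hi : i = 1 ∨ i = -1)
    (x : ℕ → Fin n → ℝ) (N : ℕ) :
    ((∑ t ∈ Finset.range (N + 1), signedStage A B Q R γ i x (inputSeq μ x) t : ℝ) : EReal)
      ≤ worstCost A B Q R γ μ (x 0) := by
  set w : ℕ → Fin n → ℝ := fun t =>
    x (t + 1) - ((-i) • (A *ᵥ x t) + B *ᵥ inputSeq μ x t) with hw
  have hx : ∀ t, x (t + 1) = (-i) • (A *ᵥ x t) + B *ᵥ inputSeq μ x t + w t := fun t => by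
    simp [hw]
  refine le_sSup ⟨-i, w, x, inputSeq μ x, N, ?_, ⟨rfl, hx, fun t => by rw [inputSeq]⟩, ?_⟩
  · rcases hi with rfl | rfl
    · exact Or.inr rfl
    · exact Or.inl (neg_neg 1)
  · rw [cost, Finset.sum_congr rfl fun t _ => signedStage_eq hi (hx t)]

/-- The adversary can secure the Riccati value over `k` further steps. -/
lemma exists_extension (hs : ∀ k, IsAdmissible γ (riccatiSeq A B Q R γ k)) (hR : R.PosDef)
    (μ : ControlLaw n m) {i : ℝ} (hi : i = 1 ∨ i = -1) (k t : ℕ) (x : ℕ → Fin n → ℝ) :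
    ∃ x' : ℕ → Fin n → ℝ, (∀ τ ≤ t, x' τ = x τ) ∧
      ∑ τ ∈ Finset.range t, signedStage A B Q R γ i x (inputSeq μ x) τ
          + qf (riccatiSeq A B Q R γ k) (x t)
        ≤ ∑ τ ∈ Finset.range (t + k), signedStage A B Q R γ i x' (inputSeq μ x') τ := by
  induction k generalizing t x with
  | zero => exact ⟨x, fun _ _ => rfl, by simp [riccatiSeq, qf]⟩
  | succ k ih =>
    obtain ⟨v, hv⟩ := exists_worst_next (A := A) (B := B) (Q := Q) (hs k) hR (x t)
      (inputSeq μ x t) hi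
    set x₁ := Function.update x (t + 1) v with hx₁
    have hagree : ∀ τ ≤ t, x₁ τ = x τ := fun τ hτ =>
      Function.update_of_ne (by omega) _ _
    have hu : ∀ τ ≤ t, inputSeq μ x₁ τ = inputSeq μ x τ := fun τ hτ =>
      inputSeq_congr μ τ fun s hs => hagree s (hs.trans hτ)
    have hnew : x₁ (t + 1) = v := Function.update_self _ _ _
    obtain ⟨x', hx', hle⟩ := ih (t + 1) x₁
    refine ⟨x', fun τ hτ => (hx' τ (by omega)).trans (hagree τ hτ), ?_⟩
    rw [show t + (k + 1) = t + 1 + k by ring]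
    refine le_trans ?_ hle
    have hsum : ∑ τ ∈ Finset.range t, signedStage A B Q R γ i x₁ (inputSeq μ x₁) τ
        = ∑ τ ∈ Finset.range t, signedStage A B Q R γ i x (inputSeq μ x) τ :=
      Finset.sum_congr rfl fun τ hτ => by
        have := Finset.mem_range.1 hτ
        rw [signedStage, signedStage, hagree τ (by omega), hagree (τ + 1) (by omega),
          hu τ (by omega)]
    rw [Finset.sum_range_succ, hsum, hnew, signedStage, hnew, hagree t le_rfl, hu t le_rfl]
    have := PosSemidef.qf_nonneg ((hs k).input_posDef (B := B) hR).posSemidef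
      (inputSeq μ x t - i • (gain A B R γ (riccatiSeq A B Q R γ k) *ᵥ x t))
    rw [riccatiSeq]
    linarith

/-- At time zero there are no data, so the fair mixture `σ = 0` secures `T` in place of `P` in the
first step. The adversary then commits to the better sign and collects the Riccati iterate over `k`
more steps. -/
lemma le_gameValue (hs : ∀ k, IsAdmissible γ (riccatiSeq A B Q R γ k)) (hR : R.PosDef)
    (x₀ : Fin n → ℝ) (k : ℕ) :
    ((qf (openLoop A Q γ (riccatiSeq A B Q R γ k)) x₀ : ℝ) : EReal)
      ≤ gameValue A B Q R γ x₀ := by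
  refine le_iInf fun μ => ?_
  obtain ⟨v, i, hi, hv⟩ := exists_next_ge (A := A) (B := B) (Q := Q) (hs k) hR x₀
    (inputSeq μ (fun _ => x₀) 0) 0 (σ := 0) (by norm_num) (by norm_num)
  set x₁ : ℕ → Fin n → ℝ := Function.update (fun _ => x₀) 1 v with hx₁
  have h0 : x₁ 0 = x₀ := Function.update_of_ne (by norm_num) _ _
  have h1 : x₁ 1 = v := Function.update_self _ _ _
  have hu : inputSeq μ x₁ 0 = inputSeq μ (fun _ => x₀) 0 :=
    inputSeq_congr μ 0 fun τ hτ => by rw [Nat.le_zero.1 hτ, h0]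
  obtain ⟨x', hx', hle⟩ := exists_extension hs hR μ hi k 1 x₁
  have h3 := sum_signedStage_le_worstCost (A := A) (B := B) (Q := Q) (R := R) (γ := γ) μ hi x' k
  rw [hx' 0 (by norm_num), h0, add_comm k 1] at h3
  refine le_trans (EReal.coe_le_coe_iff.2 (le_trans ?_ hle)) h3
  rw [Finset.sum_range_one, signedStage, h0, zero_add, h1, hu]
  linarith

lemma valueFn_zero (hd : ∀ x, 0 ≤ qf (openLoop A Q γ P - P) x) (x : Fin n → ℝ) :
    valueFn A Q γ P x 0 = qf (openLoop A Q γ P) x := by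
  have h := hd x
  have h1 := qf_sub_matrix (M := openLoop A Q γ P) (N := P) x
  rw [valueFn, satValue, abs_zero]
  split_ifs with h2
  · linarith
  · simp only [ne_eq, OfNat.ofNat_ne_zero, not_false_eq_true, zero_pow, zero_div]; linarith

/-- The saturated law keeps the cost below the value function. -/
lemma worstCost_satLaw_le (hP : IsAdmissible γ P) (hR : R.PosDef)
    (hRic : riccatiOp A B Q R γ P = P) (hA : IsUnit A)
    (hT : Tmat A Q γ P = openLoop A Q γ P)
    (hb : ∀ θ σ : ℝ, -1 ≤ θ → θ ≤ 1 → -1 ≤ σ → σ ≤ 1 →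
      PointwiseBound (gapMatrix γ P) (openLoop A Q γ P - P) (B * gain A B R γ P * A⁻¹) θ σ)
    (x₀ : Fin n → ℝ) :
    worstCost A B Q R γ (satLaw A B Q γ P (gain A B R γ P)) x₀
      ≤ ((qf (openLoop A Q γ P) x₀ : ℝ) : EReal) := by
  refine sSup_le ?_
  rintro _ ⟨i, w, x, u, N, hi, ⟨hx0, hx, hu⟩, rfl⟩
  rw [EReal.coe_le_coe_iff]
  set y : ℕ → ℝ := fun t => ∑ τ ∈ Finset.range t, corr A B γ (x τ) (u τ) (x (τ + 1)) with hy
  have hlaw : ∀ t, u t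
      = sat (y t / qf (openLoop A Q γ P - P) (x t)) • (gain A B R γ P *ᵥ x t) := fun t => by
    have h1 : γ ^ 2 * ∑ τ : Fin t, (B *ᵥ u τ - x (τ + 1)) ⬝ᵥ (A *ᵥ x τ) = y t := by
      rw [Fin.sum_univ_eq_sum_range (fun τ => (B *ᵥ u τ - x (τ + 1)) ⬝ᵥ (A *ᵥ x τ)),
        Finset.mul_sum]
      rfl
    have h2 := hu t
    rw [satLaw, hT] at h2
    rw [← h1]
    exact h2
  -- `valueFn` along the trajectory plus the accumulated stage cost is nonincreasing.
  have hsum : ∀ t, ∑ τ ∈ Finset.range t, stage A B Q R γ (x τ) (u τ) (x (τ + 1))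
      + valueFn A Q γ P (x t) (y t) ≤ valueFn A Q γ P x₀ 0 := by
    intro t
    induction t with
    | zero => simp [hy, hx0]
    | succ t ih =>
      have h := step_le_valueFn hP hR hRic hA hb (x t) (x (t + 1)) (y t) (hlaw t)
      have hy1 : y (t + 1) = y t + corr A B γ (x t) (u t) (x (t + 1)) :=
        Finset.sum_range_succ _ _
      rw [Finset.sum_range_succ, hy1]
      linarith
  -- The plant sign `i` appears as `-i` because `y` correlates `B u - x⁺`, not `x⁺ - B u`, with `A
  -- x`.
  have hcost : cost Q R γ w x u N
      = ∑ τ ∈ Finset.range (N + 1), stage A B Q R γ (x τ) (u τ) (x (τ + 1))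
        + 2 * (-i) * y (N + 1) := by
    have hi' : -i = 1 ∨ -i = -1 := by rcases hi with rfl | rfl <;> simp
    rw [cost, hy, Finset.mul_sum, ← Finset.sum_add_distrib]
    refine Finset.sum_congr rfl fun t _ => ?_
    rw [← signedStage_eq hi' (by rw [neg_neg]; exact hx t), signedStage]
  have h1 := hsum (N + 1)
  have h2 := le_valueFn hP hR hRic (x (N + 1)) (y (N + 1))
  have h3 := PosSemidef.qf_nonneg hP.1 (x (N + 1))
  have h4 : -i * y (N + 1) ≤ |y (N + 1)| := by
    rcases hi with rfl | rfl
    · linarith [neg_le_abs (y (N + 1))]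
    · linarith [le_abs_self (y (N + 1))]
  rw [valueFn_zero (qf_openLoop_sub_nonneg hP hR hRic)] at h1
  rw [hcost]
  linarith

end Game

end SignGame

end

theorem theorem2 {n m : ℕ}
    (A : Matrix (Fin n) (Fin n) ℝ) (B : Matrix (Fin n) (Fin m) ℝ)
    (Q : Matrix (Fin n) (Fin n) ℝ) (R : Matrix (Fin m) (Fin m) ℝ) (γ : ℝ)
    (hQ : Q.PosDef) (hR : R.PosDef) (hγ : 0 < γ)
    (P : Matrix (Fin n) (Fin n) ℝ) (K : Matrix (Fin m) (Fin n) ℝ)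
    (hP : SignGame.IsRiccatiSolution A B Q R γ P)
    (hK : SignGame.IsRiccatiGain A B Q R γ P K)
    -- the two inverses that occur in the matrix inequality exist
    (hA : IsUnit A) (hT : IsUnit (SignGame.Tmat A Q γ P - P)) :
    (SignGame.ConditionI A B Q R γ P ↔ SignGame.ConditionII A B Q γ P K) ∧
    (SignGame.ConditionI A B Q R γ P → SignGame.ConditionII A B Q γ P K →
      SignGame.IsLeastRiccatiSolution A B Q R γ P →
      SignGame.IsOptimal A B Q R γ (SignGame.satLaw A B Q γ P K) ∧
      ∀ (x : Fin n → ℝ) (Z : SignGame.ZMat n), Z.PosSemidef →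
        Filter.Tendsto (fun k => SignGame.V A B Q R γ k x Z) Filter.atTop
          (nhds ((SignGame.Vstar A Q γ P x Z : ℝ) : EReal))) := by
  have hPa := hP.isAdmissible
  have hRic := hP.riccatiOp_eq hQ hR
  have hTm := SignGame.Tmat_eq_openLoop (A := A) (Q := Q) hγ hP.1 hPa.2
  rw [hTm] at hT
  have hD := SignGame.openLoop_sub_posDef hPa hQ hR hRic hT
  have hs : ∀ k, SignGame.IsAdmissible γ (SignGame.riccatiSeq A B Q R γ k) := fun k =>
    (SignGame.riccatiSeq_le hPa hQ hR hRic k).1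
  obtain rfl := hK.eq_gain hPa hR
  have hbound : SignGame.ConditionII A B Q γ P (SignGame.gain A B R γ P) →
      ∀ θ σ : ℝ, -1 ≤ θ → θ ≤ 1 → -1 ≤ σ → σ ≤ 1 →
        SignGame.PointwiseBound (SignGame.gapMatrix γ P) (SignGame.openLoop A Q γ P - P)
          (B * SignGame.gain A B R γ P * A⁻¹) θ σ := fun h θ σ h1 h2 h3 h4 => by
    rw [SignGame.ConditionII, hTm] at h
    exact SignGame.pointwiseBound_of_posSemidef hPa.2 hD h h1 h2 h3 h4
  refine ⟨⟨fun h => ?_, fun h => ⟨fun x₀ => ⟨?_, ?_⟩, fun k hk x Z hZ => ?_⟩⟩,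
    fun _ h hleast => ⟨fun x₀ => le_antisymm ?_ (iInf_le _ _), fun x Z hZ => ?_⟩⟩
  · rw [SignGame.ConditionII, hTm]
    exact SignGame.posSemidef_of_pointwiseBound hPa.2 hD fun σ h1 h2 =>
      SignGame.pointwiseBound_of_Vbar hPa hR hγ hRic hA
        -- Only the equality `V̄_2 = V̄_1` from condition (i) enters.
        (fun x Z hZ => h.2 2 one_le_two x Z hZ) h1.le h2.le
  · exact ne_top_of_le_ne_top (EReal.coe_ne_top _) ((iInf_le _ _).trans
      (SignGame.worstCost_satLaw_le hPa hR hRic hA hTm (hbound h) x₀))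
  · exact ne_bot_of_le_ne_bot (EReal.coe_ne_bot _) (SignGame.le_gameValue hs hR x₀ 0)
  · obtain ⟨k, rfl⟩ := Nat.exists_eq_add_of_le' hk
    rw [SignGame.Vbar_eq hPa hR hRic hA (hbound h) k x Z hZ,
      SignGame.Vbar_one_eq hPa hR hRic x Z hZ]
  · refine (SignGame.worstCost_satLaw_le hPa hR hRic hA hTm (hbound h) x₀).trans ?_
    -- Leastness of `P` makes the lower bounds `|x₀|²_{T_k}`, with `T_k` formed from the `k`-th
    -- Riccati iterate, converge to the upper bound `|x₀|²_T`.
    have hlim := ((SignGame.continuous_qf_matrix x₀).tendsto _).comp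
      ((hPa.continuousAt_openLoop (A := A) (Q := Q)).tendsto.comp
        (SignGame.riccatiSeq_tendsto hQ hR hleast))
    exact le_of_tendsto' ((continuous_coe_real_ereal.tendsto _).comp hlim) fun k =>
      SignGame.le_gameValue hs hR x₀ k
  · rw [SignGame.Vstar_eq hTm x hZ]
    exact SignGame.V_tendsto hQ hR hA hleast (hbound h) x Z hZ
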